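/- Let $\phi:\mathbb{R}\to[0,\infty)$ be a Young function, i.e. convex, even, with $\phi(t)=0$ if and only if $t=0$. For a set $S$ let $\ell^\phi(S)$ be the Banach space of functions $f:S\to\mathbb{R}$ with $\sum_{x\in S}\phi(f(x)/\alpha)<\infty$ for some $\alpha>0$, with the Luxemburg norm $\|f\|_\phi=\inf\{\alpha>0:\sum_{x\in S}\phi(f(x)/\alpha)\le 1\}$. Let $G$ be a discrete group acting by simplicial automorphisms on a locally finite simplicial complex $X$ whose geometric realization $|X|$ is contractible, and suppose that the induced action on $|X|$ is properly discontinuous, cocompact and free. Let $G$ act on $\ell^\phi(G)$ by the right regular representation $(\pi(g)f)(x)=f(xg)$. For $k\ge 0$ let $C(G^{k+1},\ell^\phi(G))^G$ be the space of continuous maps $\omega:G^{k+1}\to\ell^\phi(G)$ with $\pi(g)\bigl(\omega(g^{-1}x_0,\dots,g^{-1}x_k)\bigr)=\omega(x_0,\dots,x_k)$ for all $g,x_0,\dots,x_k\in G$, with the compact-open topology and the derivative $(d\omega)(x_0,\dots,x_{k+1})=\sum_{i=0}^{k+1}(-1)^i\omega(x_0,\dots,\hat x_i,\dots,x_{k+1})$.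 Let $\ell^\phi(X^{(k)})$ be the space of real simplicial $k$-cochains $\theta$ of $X$ (functions of oriented $k$-simplices that change sign with the orientation) that are $\ell^\phi$ over the set $X^{(k)}$ of $k$-simplices of $X$, with the Luxemburg norm, and let $d\theta(\sigma)=\theta(\partial\sigma)$ be the simplicial coboundary. Then $d$ is a well-defined continuous linear map $\ell^\phi(X^{(k)})\to\ell^\phi(X^{(k+1)})$ for every $k$, and the complexes $\bigl(C(G^{*+1},\ell^\phi(G))^G,d\bigr)$ and $\bigl(\ell^\phi(X^{(*)}),d\bigr)$ are homotopy equivalent, through continuous linear cochain maps and continuous linear homotopies. Consequently, for every $k\ge 0$ their cohomology spaces $\mathrm{Ker}\,d_k/\mathrm{Im}\,d_{k-1}$ are isomorphic as topological vector spaces, and so are their reduced cohomology spaces $\mathrm{Ker}\,d_k/\overline{\mathrm{Im}\,d_{k-1}}$ (where $\mathrm{Im}\,d_{-1}=0$). -/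

import Mathlib

open scoped ENNReal

namespace OrliczCohomology

noncomputable section

/-! ### Young functions and the sequence spaces `ℓ^φ(S)` -/

/-- A Young function: `φ : ℝ → [0, ∞)` convex, even, and vanishing exactly at `0`. -/
structure YoungFunction where
  toFun : ℝ → ℝ
  nonneg : ∀ t, 0 ≤ toFun t
  convex : ConvexOn ℝ Set.univ toFun
  even : ∀ t, toFun (-t) = toFun t
  eq_zero_iff : ∀ t, toFun t = 0 ↔ t = 0

namespace YoungFunction

instance : CoeFun YoungFunction (fun _ => ℝ → ℝ) := ⟨YoungFunction.toFun⟩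

/-- The Young function `c φ`, for `c > 0`. -/
def scale (φ : YoungFunction) (c : ℝ) (hc : 0 < c) : YoungFunction where
  toFun t := c * φ t
  nonneg t := mul_nonneg hc.le (φ.nonneg t)
  convex := φ.convex.smul hc.le
  even t := by rw [φ.even]
  eq_zero_iff t := by rw [mul_eq_zero, φ.eq_zero_iff]; simp [hc.ne']

/-- The modular `ρ_φ(f) = ∑_{x ∈ S} φ(f(x))`, with values in `[0, ∞]`. -/
def modular (φ : YoungFunction) {S : Type*} (f : S → ℝ) : ℝ≥0∞ :=
  ∑' x, ENNReal.ofReal (φ (f x))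

variable (φ : YoungFunction) {S : Type*}

theorem map_zero : φ 0 = 0 := (φ.eq_zero_iff 0).2 rfl

theorem modular_convex (f g : S → ℝ) {a b : ℝ} (ha : 0 ≤ a) (hb : 0 ≤ b) (hab : a + b = 1) :
    φ.modular (a • f + b • g) ≤
      ENNReal.ofReal a * φ.modular f + ENNReal.ofReal b * φ.modular g := by
  unfold modular
  rw [← ENNReal.tsum_mul_left, ← ENNReal.tsum_mul_left, ← ENNReal.tsum_add]
  refine ENNReal.tsum_le_tsum fun x => ?_
  rw [← ENNReal.ofReal_mul ha, ← ENNReal.ofReal_mul hb,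
    ← ENNReal.ofReal_add (mul_nonneg ha (φ.nonneg _)) (mul_nonneg hb (φ.nonneg _))]
  exact ENNReal.ofReal_le_ofReal (φ.convex.2 (Set.mem_univ _) (Set.mem_univ _) ha hb hab)

theorem modular_zero : φ.modular (0 : S → ℝ) = 0 := by
  simp [modular, φ.map_zero]

theorem modular_smul_le (f : S → ℝ) {c : ℝ} (hc : |c| ≤ 1) :
    φ.modular (c • f) ≤ ENNReal.ofReal |c| * φ.modular f := by
  have h : φ.modular (c • f) = φ.modular (|c| • f) := by
    unfold modular
    congr 1
    funext x
    rcases abs_choice c with h | h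
    · rw [h]
    · rw [h, Pi.smul_apply, Pi.smul_apply, neg_smul, φ.even]
  rw [h]
  simpa [φ.modular_zero] using φ.modular_convex f 0 (abs_nonneg c) (sub_nonneg.2 hc) (by ring)

/-- The functions `f : S → ℝ` with `ρ_φ(f / α) < ∞` for some `α > 0`. -/
def ellSubmodule (S : Type*) : Submodule ℝ (S → ℝ) where
  carrier := {f | ∃ α : ℝ, 0 < α ∧ φ.modular (α⁻¹ • f) < ⊤}
  zero_mem' := ⟨1, one_pos, by rw [smul_zero, φ.modular_zero]; exact ENNReal.zero_lt_top⟩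
  add_mem' := by
    rintro f g ⟨α, hα, hf⟩ ⟨β, hβ, hg⟩
    refine ⟨α + β, by positivity, ?_⟩
    have h : (α + β)⁻¹ • (f + g) = (α / (α + β)) • (α⁻¹ • f) + (β / (α + β)) • (β⁻¹ • g) := by
      rw [smul_smul, smul_smul, smul_add]
      congr 2 <;> field_simp
    rw [h]
    refine (φ.modular_convex _ _ (by positivity) (by positivity) (by field_simp)).trans_lt ?_
    exact ENNReal.add_lt_top.2 ⟨ENNReal.mul_lt_top ENNReal.ofReal_lt_top hf,
      ENNReal.mul_lt_top ENNReal.ofReal_lt_top hg⟩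
  smul_mem' := by
    rintro c f ⟨α, hα, hf⟩
    refine ⟨α * (|c| + 1), by positivity, ?_⟩
    have h : (α * (|c| + 1))⁻¹ • (c • f) = (c / (|c| + 1)) • (α⁻¹ • f) := by
      rw [smul_smul, smul_smul]
      congr 1
      have := abs_nonneg c
      field_simp
    rw [h]
    refine (φ.modular_smul_le _ ?_).trans_lt (ENNReal.mul_lt_top ENNReal.ofReal_lt_top hf)
    rw [abs_div, abs_of_pos (show 0 < |c| + 1 by positivity), div_le_one (by positivity)]
    linarith

/-- The Orlicz space `ℓ^φ(S)` of a set `S` with the counting measure. -/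
def Ell (S : Type*) : Type _ := ↥(φ.ellSubmodule S)

namespace Ell

variable {φ}

instance : AddCommGroup (φ.Ell S) := inferInstanceAs (AddCommGroup ↥(φ.ellSubmodule S))

instance : Module ℝ (φ.Ell S) := inferInstanceAs (Module ℝ ↥(φ.ellSubmodule S))

instance : CoeFun (φ.Ell S) (fun _ => S → ℝ) := ⟨fun f => f.1⟩

@[ext] theorem ext {f g : φ.Ell S} (h : ∀ x, f x = g x) : f = g := Subtype.ext (funext h)

@[simp] theorem zero_apply (x : S) : (0 : φ.Ell S) x = 0 := rfl

@[simp] theorem add_apply (f g : φ.Ell S) (x : S) : (f + g) x = f x + g x := rfl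

@[simp] theorem smul_apply (c : ℝ) (f : φ.Ell S) (x : S) : (c • f) x = c * f x := rfl

/-- The Luxemburg norm `‖f‖_φ = inf {α > 0 : ρ_φ(f / α) ≤ 1}`. -/
instance : Norm (φ.Ell S) :=
  ⟨fun f => sInf {α : ℝ | 0 < α ∧ φ.modular (fun x => f x / α) ≤ 1}⟩

theorem norm_eq_gauge (f : φ.Ell S) :
    ‖f‖ = gauge {h : φ.Ell S | φ.modular h.1 ≤ 1} f := by
  rw [gauge_def']
  change sInf _ = _
  congr 1
  ext α
  have : (fun x => f x / α) = (α⁻¹ • f : φ.Ell S).1 := by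
    funext x
    change f x / α = α⁻¹ * f x
    ring
  simp [this]

theorem convex_ball : Convex ℝ {h : φ.Ell S | φ.modular h.1 ≤ 1} := by
  intro f hf g hg a b ha hb hab
  have hf' : φ.modular f.1 ≤ 1 := hf
  have hg' : φ.modular g.1 ≤ 1 := hg
  change φ.modular (a • f.1 + b • g.1) ≤ 1
  calc _ ≤ _ := φ.modular_convex f.1 g.1 ha hb hab
    _ ≤ ENNReal.ofReal a * 1 + ENNReal.ofReal b * 1 := by gcongr
    _ = 1 := by rw [mul_one, mul_one, ← ENNReal.ofReal_add ha hb, hab, ENNReal.ofReal_one]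

theorem balanced_ball : Balanced ℝ {h : φ.Ell S | φ.modular h.1 ≤ 1} := by
  rintro c hc _ ⟨f, hf, rfl⟩
  have hf' : φ.modular f.1 ≤ 1 := hf
  rw [Real.norm_eq_abs] at hc
  change φ.modular (c • f.1) ≤ 1
  calc _ ≤ _ := φ.modular_smul_le f.1 hc
    _ ≤ 1 * 1 := by
      gcongr
      exact ENNReal.ofReal_le_one.2 hc
    _ = 1 := one_mul 1

theorem absorbent_ball : Absorbent ℝ {h : φ.Ell S | φ.modular h.1 ≤ 1} := by
  intro f
  obtain ⟨α, hα, hf⟩ := f.2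
  set M : ℝ := (φ.modular (α⁻¹ • f.1)).toReal with hM
  have hM0 : 0 ≤ M := ENNReal.toReal_nonneg
  have hmem : (α * (M + 1))⁻¹ • f ∈ {h : φ.Ell S | φ.modular h.1 ≤ 1} := by
    have h : ((α * (M + 1))⁻¹ • f : φ.Ell S).1 = (M + 1)⁻¹ • (α⁻¹ • f.1) := by
      rw [smul_smul, ← mul_inv, mul_comm]
      rfl
    change φ.modular _ ≤ 1
    rw [h]
    have h1 : |(M + 1)⁻¹| ≤ 1 := by
      rw [abs_of_pos (by positivity)]
      exact inv_le_one_of_one_le₀ (by linarith)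
    refine (φ.modular_smul_le _ h1).trans ?_
    rw [abs_of_pos (by positivity), ← ENNReal.ofReal_toReal hf.ne, ← hM,
      ← ENNReal.ofReal_mul (by positivity)]
    refine ENNReal.ofReal_le_one.2 ?_
    rw [inv_mul_le_iff₀ (by positivity)]
    linarith
  refine absorbs_iff_norm.2 ⟨α * (M + 1), fun c hc => ?_⟩
  have hpos : 0 < α * (M + 1) := by positivity
  have hc0 : c ≠ 0 := by
    rintro rfl
    simp at hc
    linarith
  rw [Set.singleton_subset_iff, Set.mem_smul_set_iff_inv_smul_mem₀ hc0]
  have h2 : c⁻¹ • f = (c⁻¹ * (α * (M + 1))) • ((α * (M + 1))⁻¹ • f) := by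
    rw [smul_smul, mul_assoc, mul_inv_cancel₀ hpos.ne', mul_one]
  rw [h2]
  refine balanced_ball.smul_mem ?_ hmem
  rw [norm_mul, norm_inv, Real.norm_of_nonneg hpos.le, inv_mul_le_iff₀ (norm_pos_iff.2 hc0)]
  linarith

theorem eq_zero_of_norm_eq_zero (f : φ.Ell S) (h : ‖f‖ = 0) : f = 0 := by
  ext x
  by_contra hx
  have hx' : f x ≠ 0 := hx
  have hpos : 0 < φ (f x) :=
    lt_of_le_of_ne (φ.nonneg _) (fun h0 => hx' ((φ.eq_zero_iff _).1 h0.symm))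
  rw [norm_eq_gauge] at h
  obtain ⟨r, hr0, hr, y, hy, hyf⟩ := exists_lt_of_gauge_lt absorbent_ball
    (show gauge {h : φ.Ell S | φ.modular h.1 ≤ 1} f < min 1 (φ (f x)) by
      rw [h]; exact lt_min one_pos hpos)
  have hy1 : φ (y x) ≤ 1 := by
    have h1 : ENNReal.ofReal (φ (y x)) ≤ 1 :=
      (ENNReal.le_tsum (f := fun z => ENNReal.ofReal (φ (y z))) x).trans hy
    exact ENNReal.ofReal_le_one.1 h1
  have hfx : f x = r * y x := by rw [← hyf]; rfl
  have hr1 : r < 1 := hr.trans_le (min_le_left _ _)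
  have h2 : φ (f x) ≤ r * φ (y x) := by
    have := φ.convex.2 (Set.mem_univ (y x)) (Set.mem_univ 0) hr0.le (sub_nonneg.2 hr1.le) (by ring)
    simpa [φ.map_zero, hfx] using this
  have h3 : r < φ (f x) := hr.trans_le (min_le_right _ _)
  nlinarith

theorem normCore : NormedSpace.Core ℝ (φ.Ell S) where
  norm_nonneg f := by rw [norm_eq_gauge]; exact gauge_nonneg _
  norm_smul c f := by rw [norm_eq_gauge, norm_eq_gauge, gauge_smul balanced_ball]
  norm_triangle f g := by
    rw [norm_eq_gauge, norm_eq_gauge, norm_eq_gauge]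
    exact gauge_add_le convex_ball absorbent_ball f g
  norm_eq_zero_iff f := by
    refine ⟨eq_zero_of_norm_eq_zero f, ?_⟩
    rintro rfl
    rw [norm_eq_gauge, gauge_zero]

instance : NormedAddCommGroup (φ.Ell S) := NormedAddCommGroup.ofCore normCore

instance : NormedSpace ℝ (φ.Ell S) := NormedSpace.ofCore normCore

end Ell

end YoungFunction

/-! ### Complexes of topological vector spaces -/

section Complexes

/-- The coboundaries `Im d_{k-1}` in degree `k`, where `Im d_{-1} = 0`. -/
def coboundaries {A : ℕ → Type*} [∀ k, AddCommGroup (A k)] [∀ k, Module ℝ (A k)]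
    [∀ k, TopologicalSpace (A k)] (d : ∀ k, A k →L[ℝ] A (k + 1)) :
    ∀ k, Submodule ℝ (A k)
  | 0 => ⊥
  | k + 1 => (d k).range

/-- The cohomology `Ker d_k / Im d_{k-1}`, with the quotient topology. -/
abbrev Cohomology {A : ℕ → Type*} [∀ k, AddCommGroup (A k)] [∀ k, Module ℝ (A k)]
    [∀ k, TopologicalSpace (A k)] (d : ∀ k, A k →L[ℝ] A (k + 1)) (k : ℕ) : Type _ :=
  ↥(d k).ker ⧸ (coboundaries d k).comap (d k).ker.subtype

/-- The reduced cohomology: `Ker d_k` modulo the closure of `Im d_{k-1}`, with the quotient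
topology. -/
abbrev ReducedCohomology {A : ℕ → Type*} [∀ k, AddCommGroup (A k)] [∀ k, Module ℝ (A k)]
    [∀ k, TopologicalSpace (A k)] [∀ k, IsTopologicalAddGroup (A k)]
    [∀ k, ContinuousSMul ℝ (A k)] (d : ∀ k, A k →L[ℝ] A (k + 1)) (k : ℕ) : Type _ :=
  ↥(d k).ker ⧸ (coboundaries d k).topologicalClosure.comap (d k).ker.subtype

/-- Homotopy equivalence of complexes of topological vector spaces: continuous linear cochain maps
`f`, `g` in both directions, with continuous linear homotopies from `g ∘ f` and `f ∘ g` to the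
identities. -/
def HomotopyEquivalent {A B : ℕ → Type*}
    [∀ k, AddCommGroup (A k)] [∀ k, Module ℝ (A k)] [∀ k, TopologicalSpace (A k)]
    [∀ k, AddCommGroup (B k)] [∀ k, Module ℝ (B k)] [∀ k, TopologicalSpace (B k)]
    (dA : ∀ k, A k →L[ℝ] A (k + 1)) (dB : ∀ k, B k →L[ℝ] B (k + 1)) : Prop :=
  ∃ (f : ∀ k, A k →L[ℝ] B k) (g : ∀ k, B k →L[ℝ] A k)
    (h : ∀ k, A (k + 1) →L[ℝ] A k) (h' : ∀ k, B (k + 1) →L[ℝ] B k),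
    (∀ k x, f (k + 1) (dA k x) = dB k (f k x)) ∧
    (∀ k y, g (k + 1) (dB k y) = dA k (g k y)) ∧
    (∀ x, x - g 0 (f 0 x) = h 0 (dA 0 x)) ∧
    (∀ k x, x - g (k + 1) (f (k + 1) x) = dA k (h k x) + h (k + 1) (dA (k + 1) x)) ∧
    (∀ y, y - f 0 (g 0 y) = h' 0 (dB 0 y)) ∧
    (∀ k y, y - f (k + 1) (g (k + 1) y) = dB k (h' k y) + h' (k + 1) (dB (k + 1) y))

end Complexes

/-! ### Invariant continuous cochains of a group with coefficients in `ℓ^φ(G)` -/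

section GroupCochains

variable (φ : YoungFunction) (G : Type*) [Group G]

/-- The right regular representation `(π(g) f)(x) = f(x g)` on `ℓ^φ(G)`. -/
def rightRegular (g : G) : φ.Ell G →ₗ[ℝ] φ.Ell G where
  toFun f := ⟨fun x => f (x * g), by
    obtain ⟨α, hα, hf⟩ := f.2
    refine ⟨α, hα, lt_of_eq_of_lt ?_ hf⟩
    exact (Equiv.mulRight g).tsum_eq (fun x => ENNReal.ofReal (φ ((α⁻¹ • f.1) x)))⟩
  map_add' _ _ := rfl
  map_smul' _ _ := rfl

variable [TopologicalSpace G]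

/-- The space `C(G^{k+1}, ℓ^φ(G))^G` of continuous maps `ω` with
`π(g) (ω (g⁻¹ x₀, …, g⁻¹ x_k)) = ω (x₀, …, x_k)`, with the compact-open topology. -/
def InvariantCochain (k : ℕ) : Submodule ℝ C(Fin (k + 1) → G, φ.Ell G) where
  carrier := {ω | ∀ (g : G) (x : Fin (k + 1) → G),
    rightRegular φ G g (ω (fun i => g⁻¹ * x i)) = ω x}
  zero_mem' g x := map_zero _
  add_mem' := by
    intro ω η hω hη g x
    rw [ContinuousMap.add_apply, map_add, hω, hη, ContinuousMap.add_apply]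
  smul_mem' := by
    intro c ω hω g x
    rw [ContinuousMap.smul_apply, map_smul, hω, ContinuousMap.smul_apply]

/-- The pull-back of cochains under the map omitting the `i`-th variable. -/
def omitVar (k : ℕ) (i : Fin (k + 2)) :
    C(Fin (k + 1) → G, φ.Ell G) →L[ℝ] C(Fin (k + 2) → G, φ.Ell G) where
  toFun ω := ω.comp ⟨fun x j => x (i.succAbove j), by fun_prop⟩
  map_add' _ _ := rfl
  map_smul' _ _ := rfl
  cont := ContinuousMap.continuous_precomp _

/-- The derivative `(d ω)(x₀, …, x_{k+1}) = ∑ i, (-1)^i ω(x₀, …, x̂ᵢ, …, x_{k+1})` on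
`C(G^{k+1}, ℓ^φ(G))^G`. -/
def groupCoboundary (k : ℕ) : InvariantCochain φ G k →L[ℝ] InvariantCochain φ G (k + 1) :=
  ((∑ i : Fin (k + 2), (-1 : ℝ) ^ (i : ℕ) • omitVar φ G k i).comp
    (InvariantCochain φ G k).subtypeL).codRestrict (InvariantCochain φ G (k + 1)) (by
      rintro ⟨ω, hω⟩ g x
      simp only [ContinuousLinearMap.comp_apply, Submodule.subtypeL_apply,
        sum_apply, smul_apply, ContinuousMap.sum_apply,
        ContinuousMap.smul_apply, map_sum, map_smul]
      exact Finset.sum_congr rfl fun i _ =>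
        congrArg _ (hω g (fun j => x (i.succAbove j))))

end GroupCochains

/-! ### Simplicial complexes -/

section Simplicial

variable {V : Type*} (X : AbstractSimplicialComplex V)

/-- Every vertex lies in finitely many simplices. -/
def IsLocallyFinite : Prop := ∀ v : V, {s | s ∈ X.faces ∧ v ∈ s}.Finite

/-- The points of the geometric realization `|X|`, in barycentric coordinates. -/
def Realization : Type _ :=
  {t : V → ℝ // (∀ v, 0 ≤ t v) ∧ ∃ s ∈ X.faces, (∀ v, v ∉ s → t v = 0) ∧ ∑ v ∈ s, t v = 1}

/-- The closed simplex of `|X|` spanned by a face `s`, parametrized by the standard simplex. -/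
def simplexMap (s : X.faces) (t : stdSimplex ℝ {v // v ∈ s.1}) : Realization X :=
  ⟨Function.extend Subtype.val t.1 0, by
    intro v
    by_cases hv : ∃ a : {v // v ∈ s.1}, a.1 = v
    · obtain ⟨a, rfl⟩ := hv
      rw [Subtype.val_injective.extend_apply]
      exact t.2.1 a
    · rw [Function.extend_apply' _ _ _ hv]
      exact le_rfl,
   s.1, s.2, by
    intro v hv
    rw [Function.extend_apply' _ _ _ (by rintro ⟨a, rfl⟩; exact hv a.2)]
    rfl, by
    rw [← Finset.sum_coe_sort]
    simp only [Subtype.val_injective.extend_apply]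
    exact t.2.2⟩

/-- The weak topology on `|X|`: a set is open if and only if its trace on every closed simplex is
open. -/
instance : TopologicalSpace (Realization X) :=
  ⨆ s : X.faces, TopologicalSpace.coinduced (simplexMap X s) inferInstance

/-- The group `G`, acting on the vertices of `X`, acts on `X` by simplicial automorphisms. -/
class SimplicialAction (G : Type*) {V : Type*} [Group G] [MulAction G V]
    (X : AbstractSimplicialComplex V) : Prop where
  map_mem : ∀ (g : G), ∀ s ∈ X.faces, s.map (MulAction.toPerm g).toEmbedding ∈ X.faces

/-- The induced action on `|X|`, which is affine on each simplex: the barycentric coordinate of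
`g • t` at the vertex `g • v` is that of `t` at `v`. -/
instance {G : Type*} [Group G] [MulAction G V] [SimplicialAction G X] :
    MulAction G (Realization X) where
  smul g t := ⟨fun v => t.1 (g⁻¹ • v), fun v => t.2.1 _, by
    obtain ⟨s, hs, h0, h1⟩ := t.2.2
    refine ⟨_, SimplicialAction.map_mem g s hs, fun v hv => h0 _ fun h => hv ?_, ?_⟩
    · exact Finset.mem_map.2 ⟨_, h, by simp⟩
    · rw [Finset.sum_map]
      simpa using h1⟩
  one_smul t := Subtype.ext (by funext v; change t.1 ((1 : G)⁻¹ • v) = _; simp)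
  mul_smul g h t := Subtype.ext (by
    funext v
    change t.1 ((g * h)⁻¹ • v) = t.1 (h⁻¹ • g⁻¹ • v)
    rw [mul_inv_rev, mul_smul])

/-- The `k`-simplices of `X` with a total order of their vertices. -/
@[ext] structure OrderedSimplex (k : ℕ) where
  vertex : Fin (k + 1) → V
  injective : Function.Injective vertex
  mem : Finset.univ.map ⟨vertex, injective⟩ ∈ X.faces

variable {X}

/-- The face of an ordered simplex opposite to its `i`-th vertex. -/
def OrderedSimplex.face {k : ℕ} (σ : OrderedSimplex X (k + 1)) (i : Fin (k + 2)) :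
    OrderedSimplex X k where
  vertex j := σ.vertex (i.succAbove j)
  injective := σ.injective.comp Fin.succAbove_right_injective
  mem := (X.isRelLowerSet_faces σ.mem).2 (by
    intro v hv
    obtain ⟨j, -, rfl⟩ := Finset.mem_map.1 hv
    exact Finset.mem_map.2 ⟨i.succAbove j, Finset.mem_univ _, rfl⟩)
    (Finset.univ_nonempty.map)

/-- An ordered simplex with its vertices permuted. -/
def OrderedSimplex.perm {k : ℕ} (σ : OrderedSimplex X k) (p : Equiv.Perm (Fin (k + 1))) :
    OrderedSimplex X k where
  vertex j := σ.vertex (p j)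
  injective := σ.injective.comp p.injective
  mem := by
    convert σ.mem using 1
    ext v
    simp only [Finset.mem_map, Finset.mem_univ, true_and, Function.Embedding.coeFn_mk]
    exact p.exists_congr_left.trans (by simp)

variable (X)

/-- The space `ℓ^φ(X^{(k)})` of simplicial `ℓ^φ`-cochains: the real functions `θ` of the oriented
`k`-simplices of `X` which change sign with the orientation and are `φ`-summable over the set
`X^{(k)}` of `k`-simplices, with the Luxemburg norm. Such a `θ` is given as an alternating function
of ordered simplices. Each `k`-simplex has `(k+1)!` orderings, on which `φ ∘ θ` is constant since
`φ` is even, so that `∑_{σ ∈ X^{(k)}} φ(θ(σ))` is the sum of `φ(θ(σ)) / (k+1)!` over all ordered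
simplices `σ`: this is the modular of `φ / (k+1)!`. -/
def SimplicialCochain (φ : YoungFunction) (k : ℕ) :
    Submodule ℝ ((φ.scale ((k + 1).factorial : ℝ)⁻¹ (by positivity)).Ell (OrderedSimplex X k)) where
  carrier := {θ | ∀ (σ : OrderedSimplex X k) (p : Equiv.Perm (Fin (k + 1))),
    θ (σ.perm p) = ((Equiv.Perm.sign p : ℤ) : ℝ) * θ σ}
  zero_mem' σ p := by simp
  add_mem' := by
    intro θ η hθ hη σ p
    rw [YoungFunction.Ell.add_apply, hθ, hη, YoungFunction.Ell.add_apply]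
    ring
  smul_mem' := by
    intro c θ hθ σ p
    rw [YoungFunction.Ell.smul_apply, hθ, YoungFunction.Ell.smul_apply]
    ring

end Simplicial

end

end OrliczCohomology

open OrliczCohomology

namespace OrliczCohomology

noncomputable section

/-! ### Augmented chains of lists -/

/-! Both complexes are obtained by applying `Hom_G(-, ℓ^φ(G))` to acyclic complexes of free
`G`-modules. For the group complex this is the definition of an invariant cochain, applied to the
homogeneous chains on tuples in `G`. For `X`, a cochain `θ` is turned into the equivariant map
sending a simplex `σ` to the function `y ↦ θ(yσ)` on `G`. Since the action is free and has finitely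
many orbits of simplices, every orbit is a copy of `G`, and `ℓ^φ(X^{(k)})` is the alternating part
of a finite sum of copies of `ℓ^φ(G)`. The theorem then follows from the comparison of resolutions:
there are equivariant chain maps both ways and equivariant homotopies, and they are transposed to
cochains.

Continuity costs little. The transposed maps are built from finite combinations of evaluations,
restrictions to orbits and extensions by zero, which increase modulars by a bounded factor. As `G`
is discrete, the compact-open topology is that of pointwise convergence.

Chains live on lists of vertices, repetitions allowed, with the empty list as augmentation.
Equivariant maps come from acyclic carriers (`exists_lift`). Simplicial cochains are alternating, so
the map from chains of `X` to chains of `G` must be alternating as well; it is composed with the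
alternation operator `alt`, which alternating cochains do not see (`IsAlt.apply_alt`).

The geometric input is that a contractible `X` has acyclic chains (`acyclic_faceLists`), proved by
simplicial approximation of the contraction on a finely subdivided cycle.
`homotopyEquivalent_groupCoboundary` assembles the equivalence, and
`nonempty_equiv_of_homotopyEquivalent` passes to cohomology, reduced or not. -/

/-- The real chains on lists of elements of `P`. A list of length `n + 1` is an ordered `n`-simplex,
and the empty list spans the augmentation in degree `-1`. -/
abbrev Ch (P : Type*) : Type _ := List P →₀ ℝ

variable {P Q R : Type*}

/-- The generator of `Ch P` given by a list. -/
abbrev gen (l : List P) : Ch P := Finsupp.single l 1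

/-- The cone with apex `a`. -/
def cone (a : P) : Ch P →ₗ[ℝ] Ch P := Finsupp.lmapDomain ℝ ℝ (List.cons a)

@[simp] theorem cone_gen (a : P) (l : List P) : cone a (gen l) = gen (a :: l) := by
  simp [cone]

/-- Linear maps on chains which agree on lists are equal. -/
theorem Ch.hom_ext {M : Type*} [AddCommGroup M] [Module ℝ M] {f g : Ch P →ₗ[ℝ] M}
    (h : ∀ l, f (gen l) = g (gen l)) : f = g := by
  refine Finsupp.lhom_ext fun l r => ?_
  have : (Finsupp.single l r : Ch P) = r • gen l := by simp
  rw [this, map_smul, map_smul, h]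

/-- The linear map on chains with prescribed values on lists. -/
def extendLin {M : Type*} [AddCommGroup M] [Module ℝ M] (f : List P → M) : Ch P →ₗ[ℝ] M :=
  Finsupp.linearCombination ℝ f

@[simp] theorem extendLin_gen {M : Type*} [AddCommGroup M] [Module ℝ M] (f : List P → M)
    (l : List P) : extendLin f (gen l) = f l := by
  simp [extendLin]

/-- The boundary of a list. -/
def bdList : List P → Ch P
  | [] => 0
  | a :: l => gen l - cone a (bdList l)

/-- The boundary operator. -/
def bd : Ch P →ₗ[ℝ] Ch P := extendLin bdList

@[simp] theorem bd_nil : bd (gen ([] : List P)) = 0 := extendLin_gen _ _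

@[simp] theorem bd_cons (a : P) (l : List P) : bd (gen (a :: l)) = gen l - cone a (bd (gen l)) := by
  simp only [bd, extendLin_gen, bdList]

/-- Coning is a contracting homotopy of the augmented complex; the acyclicity statements below all
rest on this identity. -/
theorem bd_cone (a : P) (z : Ch P) : bd (cone a z) = z - cone a (bd z) := by
  have : bd ∘ₗ cone a = LinearMap.id - cone a ∘ₗ bd := Ch.hom_ext fun l => by simp
  exact LinearMap.congr_fun this z

theorem bd_bd (z : Ch P) : bd (bd z) = 0 := by
  have : (bd ∘ₗ bd : Ch P →ₗ[ℝ] Ch P) = 0 := by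
    refine Ch.hom_ext fun l => ?_
    simp only [LinearMap.comp_apply, LinearMap.zero_apply]
    induction l with
    | nil => simp
    | cons a l ih => rw [bd_cons, map_sub, bd_cone, ih]; simp
  exact LinearMap.congr_fun this z

/-- The chain map induced by a map of vertices. -/
def lmap (f : P → Q) : Ch P →ₗ[ℝ] Ch Q := Finsupp.lmapDomain ℝ ℝ (List.map f)

@[simp] theorem lmap_gen (f : P → Q) (l : List P) : lmap f (gen l) = gen (l.map f) := by
  simp [lmap]

theorem lmap_cone (f : P → Q) (a : P) (z : Ch P) : lmap f (cone a z) = cone (f a) (lmap f z) := by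
  have : lmap f ∘ₗ cone a = cone (f a) ∘ₗ lmap f := Ch.hom_ext fun l => by simp
  exact LinearMap.congr_fun this z

theorem bd_lmap (f : P → Q) (z : Ch P) : bd (lmap f z) = lmap f (bd z) := by
  have : bd ∘ₗ lmap f = lmap f ∘ₗ bd := by
    refine Ch.hom_ext fun l => ?_
    simp only [LinearMap.comp_apply, lmap_gen]
    induction l with
    | nil => simp
    | cons a l ih => simp [ih, lmap_cone]
  exact LinearMap.congr_fun this z

theorem lmap_lmap (f : P → Q) (g : Q → R) (z : Ch P) :
    lmap g (lmap f z) = lmap (g ∘ f) z := by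
  have : lmap g ∘ₗ lmap f = lmap (g ∘ f) := Ch.hom_ext fun l => by simp
  exact LinearMap.congr_fun this z

theorem lmap_id (z : Ch P) : lmap id z = z := by
  have : lmap (id : P → P) = LinearMap.id := Ch.hom_ext fun l => by simp
  exact LinearMap.congr_fun this z

/-! ### Chains supported on a set of lists -/

/-- The chains supported on the lists of length `n` in `B`. -/
def chains (B : Set (List P)) (n : ℕ) : Submodule ℝ (Ch P) :=
  Finsupp.supported ℝ ℝ {l | l ∈ B ∧ l.length = n}

theorem gen_mem_chains {B : Set (List P)} {n : ℕ} {l : List P} (h : l ∈ B) (hn : l.length = n) :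
    gen l ∈ chains B n :=
  Finsupp.single_mem_supported ℝ 1 ⟨h, hn⟩

theorem chains_mono {B C : Set (List P)} (h : B ⊆ C) (n : ℕ) : chains B n ≤ chains C n :=
  Finsupp.supported_mono fun _ hl => ⟨h hl.1, hl.2⟩

theorem map_mem_of_mem_chains {M : Type*} [AddCommGroup M] [Module ℝ M] {B : Set (List P)} {n : ℕ}
    (f : Ch P →ₗ[ℝ] M) (W : Submodule ℝ M) (h : ∀ l ∈ B, l.length = n → f (gen l) ∈ W)
    {z : Ch P} (hz : z ∈ chains B n) : f z ∈ W := by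
  have : chains B n ≤ W.comap f := by
    rw [chains, Finsupp.supported_eq_span_single, Submodule.span_le]
    rintro _ ⟨l, hl, rfl⟩
    exact h l hl.1 hl.2
  exact this hz

theorem eqOn_chains {M : Type*} [AddCommGroup M] [Module ℝ M] {B : Set (List P)} {n : ℕ}
    {f g : Ch P →ₗ[ℝ] M} (h : ∀ l ∈ B, l.length = n → f (gen l) = g (gen l))
    {z : Ch P} (hz : z ∈ chains B n) : f z = g z := by
  have := map_mem_of_mem_chains (f - g) ⊥ (fun l hl hn => by simp [h l hl hn]) hz
  simpa [sub_eq_zero] using this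

theorem map_eq_zero_of_mem_chains_zero {M : Type*} [AddCommGroup M] [Module ℝ M]
    {B : Set (List P)} {f : Ch P →ₗ[ℝ] M} (hf : f (gen []) = 0) {z : Ch P} (hz : z ∈ chains B 0) :
    f z = 0 :=
  eqOn_chains (g := 0) (fun l _ hl => by
    rw [List.length_eq_zero_iff.1 hl, hf]
    rfl) hz

theorem cone_mem_chains {B C : Set (List P)} {n : ℕ} {a : P} (h : ∀ l ∈ B, a :: l ∈ C)
    {z : Ch P} (hz : z ∈ chains B n) : cone a z ∈ chains C (n + 1) :=
  map_mem_of_mem_chains _ _ (fun l hl hn => by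
    rw [cone_gen]
    exact gen_mem_chains (h l hl) (by simp [hn])) hz

theorem lmap_mem_chains {B : Set (List P)} {C : Set (List Q)} {n : ℕ} {f : P → Q}
    (h : ∀ l ∈ B, l.map f ∈ C) {z : Ch P} (hz : z ∈ chains B n) : lmap f z ∈ chains C n :=
  map_mem_of_mem_chains _ _ (fun l hl hn => by
    rw [lmap_gen]
    exact gen_mem_chains (h l hl) (by simp [hn])) hz

theorem bd_gen_mem (l : List P) {n : ℕ} (hn : l.length = n + 1) :
    bd (gen l) ∈ chains {m | m.Sublist l} n := by
  induction l generalizing n with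
  | nil => simp at hn
  | cons a l ih =>
    rw [bd_cons]
    refine Submodule.sub_mem _ (gen_mem_chains (List.sublist_cons_self a l) (by simpa using hn)) ?_
    rcases n with _ | n
    · have : l = [] := by simpa using hn
      subst this
      simp
    · exact cone_mem_chains (B := {m | m.Sublist l}) (C := {m | m.Sublist (a :: l)})
        (fun m hm => List.Sublist.cons_cons a hm) (ih (by simpa using hn))

/-- A set of lists is closed under faces. -/
def FaceClosed (B : Set (List P)) : Prop := ∀ l ∈ B, ∀ m, m.Sublist l → m ∈ B

theorem FaceClosed.bd_mem {B : Set (List P)} (hB : FaceClosed B) {n : ℕ} {z : Ch P}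
    (hz : z ∈ chains B (n + 1)) : bd z ∈ chains B n :=
  map_mem_of_mem_chains _ _ (fun l hl hn =>
    chains_mono (fun _ hm => hB l hl _ hm) n (bd_gen_mem l hn)) hz

/-- Every cycle supported in `B` is the boundary of a chain supported in `B`. -/
def Acyclic (B : Set (List P)) : Prop :=
  ∀ n, ∀ z ∈ chains B n, bd z = 0 → ∃ w ∈ chains B (n + 1), bd w = z

theorem Acyclic.of_cons_mem {B : Set (List P)} (a : P) (h : ∀ l ∈ B, a :: l ∈ B) : Acyclic B :=
  fun _ z hz hbd => ⟨cone a z, cone_mem_chains h hz, by rw [bd_cone, hbd, map_zero, sub_zero]⟩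

/-- The lists with entries in a set. -/
def listsIn (U : Set P) : Set (List P) := {l | ∀ x ∈ l, x ∈ U}

theorem listsIn_mono {U U' : Set P} (h : U ⊆ U') : listsIn U ⊆ listsIn U' :=
  fun _ hl x hx => h (hl x hx)

theorem acyclic_listsIn {U : Set P} {a : P} (ha : a ∈ U) : Acyclic (listsIn U) :=
  Acyclic.of_cons_mem a fun l hl x hx => by
    rcases List.mem_cons.1 hx with rfl | hx
    exacts [ha, hl x hx]

theorem faceClosed_listsIn (U : Set P) : FaceClosed (listsIn U) :=
  fun _ hl _ hm x hx => hl x (hm.subset hx)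

/-! ### Acyclic carriers -/

/-- An equivariant choice: a relation between a free action and another action that is compatible
with the actions and total on an invariant set contains an equivariant function on that set. -/
theorem exists_equivariant_choice {Γ α β : Type*} [Group Γ] [MulAction Γ α] [MulAction Γ β]
    [Nonempty β] (D : Set α) (hD : ∀ (g : Γ), ∀ x ∈ D, g • x ∈ D)
    (hfree : ∀ (g : Γ), ∀ x ∈ D, g • x = x → g = 1) (r : α → β → Prop)
    (hr : ∀ (g : Γ), ∀ x ∈ D, ∀ y, r x y → r (g • x) (g • y)) (htot : ∀ x ∈ D, ∃ y, r x y) :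
    ∃ f : α → β, (∀ x ∈ D, r x (f x)) ∧ ∀ (g : Γ), ∀ x ∈ D, f (g • x) = g • f x := by
  classical
  let rep : α → α := fun x => (Quotient.mk (MulAction.orbitRel Γ α) x).out
  have hrep : ∀ x, ∃ g : Γ, g • rep x = x := fun x => by
    have h : (MulAction.orbitRel Γ α).r (rep x) x := Quotient.exact (Quotient.out_eq _)
    obtain ⟨g, hg⟩ := MulAction.orbitRel_apply.1 ((MulAction.orbitRel Γ α).symm h)
    exact ⟨g, hg⟩
  choose t ht using hrep
  have hrepD : ∀ x ∈ D, rep x ∈ D := fun x hx => by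
    have := hD (t x)⁻¹ x hx
    rwa [inv_smul_eq_iff.2 (ht x).symm] at this
  choose! c hc using htot
  refine ⟨fun x => t x • c (rep x), fun x hx => ?_, fun g x hx => ?_⟩
  · have := hr (t x) _ (hrepD x hx) _ (hc _ (hrepD x hx))
    rwa [ht] at this
  · have h1 : rep (g • x) = rep x := by
      change Quotient.out _ = Quotient.out _
      congr 1
      exact Quotient.sound (MulAction.orbitRel_apply.2 ⟨g, rfl⟩)
    -- Freeness makes the group element carrying the representative to a given point unique, which
    -- forces `t` to be equivariant.
    have h2 : t (g • x) = g * t x := by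
      have h3 : ((g * t x)⁻¹ * t (g • x)) • rep x = rep x := by
        rw [mul_smul, inv_smul_eq_iff, mul_smul, ht, ← h1, ht]
      have := hfree _ _ (hrepD x hx) h3
      rw [inv_mul_eq_one] at this
      exact this.symm
    change t (g • x) • c (rep (g • x)) = g • t x • c (rep x)
    rw [h1, h2, mul_smul]

section Lift

variable {Γ : Type*} [Group Γ] [MulAction Γ P] [MulAction Γ Q]

/-- The action of a group on lists. -/
@[reducible] def listAction (Γ P : Type*) [Group Γ] [MulAction Γ P] : MulAction Γ (List P) where
  smul g l := l.map (g • ·)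
  one_smul l := by change l.map _ = l; simp
  mul_smul g h l := by
    change l.map _ = (l.map _).map _
    simp [mul_smul, Function.comp_def]

/-- The action of a group on chains. -/
@[reducible] def chainAction (Γ P : Type*) [Group Γ] [MulAction Γ P] : MulAction Γ (Ch P) where
  smul g z := lmap (g • ·) z
  one_smul z := by
    change lmap _ z = z
    simpa [Function.id_def] using lmap_id z
  mul_smul g h z := by
    change lmap _ z = lmap _ (lmap _ z)
    rw [lmap_lmap]
    congr 2
    funext x
    exact mul_smul g h x

/-- The chain `u + ε h ∂` is a cycle: by the equation for `h` one degree lower, with its own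
predecessor `k`, its boundary is `∂u + ε u ∂ + ε² k ∂∂`, which vanishes by `hu`. It is supported in
`Φ l` because `Φ` is monotone under passing to faces, so acyclicity gives a primitive there.
Freeness allows the primitives to be chosen orbit by orbit. -/
theorem exists_lift_step (hfree : ∀ (g : Γ) (p : P), g • p = p → g = 1)
    {A : Set (List P)} (hA : FaceClosed A) (hAG : ∀ (g : Γ), ∀ l ∈ A, l.map (g • ·) ∈ A)
    (Φ : List P → Set (List Q))
    (hΦ : ∀ l ∈ A, ∀ m, m.Sublist l → Φ m ⊆ Φ l)
    (hΦG : ∀ (g : Γ), ∀ l ∈ A, ∀ m ∈ Φ l, m.map (g • ·) ∈ Φ (l.map (g • ·)))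
    (hac : ∀ l ∈ A, l ≠ [] → Acyclic (Φ l)) (s : ℕ) (ε : ℝ)
    (u : Ch P →ₗ[ℝ] Ch Q)
    (huG : ∀ (g : Γ), ∀ l ∈ A, u (gen (l.map (g • ·))) = lmap (g • ·) (u (gen l)))
    (hu : ∀ l ∈ A, bd (u (gen l)) + ε • u (bd (gen l)) = 0)
    (huΦ : ∀ l ∈ A, ∀ n, l.length = n + 1 → u (gen l) ∈ chains (Φ l) (n + s))
    (n : ℕ) (h k : Ch P →ₗ[ℝ] Ch Q)
    (hG : ∀ (g : Γ), ∀ l ∈ A, l.length = n →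
      h (gen (l.map (g • ·))) = lmap (g • ·) (h (gen l)))
    (hh : ∀ l ∈ A, l.length = n → h (gen l) ∈ chains (Φ l) (n + s) ∧
      bd (h (gen l)) = u (gen l) + ε • k (bd (gen l))) :
    ∃ h' : Ch P →ₗ[ℝ] Ch Q,
      (∀ (g : Γ), ∀ l ∈ A, l.length = n + 1 →
        h' (gen (l.map (g • ·))) = lmap (g • ·) (h' (gen l))) ∧
      (∀ l ∈ A, l.length = n + 1 → h' (gen l) ∈ chains (Φ l) (n + 1 + s) ∧
        bd (h' (gen l)) = u (gen l) + ε • h (bd (gen l))) := by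
  let := listAction Γ P
  let := chainAction Γ Q
  have hbdA : ∀ l ∈ A, l.length = n + 1 → bd (gen l) ∈ chains A n := fun l hl hn =>
    hA.bd_mem (gen_mem_chains hl hn)
  obtain ⟨f, hf, hfG⟩ := exists_equivariant_choice (Γ := Γ) (β := Ch Q)
    {l : List P | l ∈ A ∧ l.length = n + 1}
    (fun g l hl => ⟨hAG g l hl.1, (List.length_map _).trans hl.2⟩)
    (fun g l hl hgl => by
      -- An element fixing a nonempty list fixes its first entry. The empty list is fixed by all of
      -- `Γ`, which is why the value there is prescribed in `exists_lift`.
      rcases l with _ | ⟨a, l⟩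
      · simp at hl
      · exact hfree g a (List.cons.inj (show g • a :: l.map (g • ·) = a :: l from hgl)).1)
    (fun l m => m ∈ chains (Φ l) (n + 1 + s) ∧ bd m = u (gen l) + ε • h (bd (gen l)))
    (by
      rintro g l ⟨hl, hn⟩ m ⟨hm, hbd⟩
      refine ⟨lmap_mem_chains (hΦG g l hl) hm, ?_⟩
      change bd (lmap (g • ·) m) = u (gen (l.map (g • ·))) + ε • h (bd (gen (l.map (g • ·))))
      rw [bd_lmap, hbd, map_add, map_smul, huG g l hl, ← lmap_gen, bd_lmap]
      congr 2
      exact (eqOn_chains (f := h ∘ₗ lmap (g • ·)) (g := lmap (g • ·) ∘ₗ h)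
        (fun l hl hn => by simpa using hG g l hl hn) (hbdA l hl hn)).symm)
    (by
      rintro l ⟨hl, hn⟩
      have h1 : h (bd (gen l)) ∈ chains (Φ l) (n + s) :=
        map_mem_of_mem_chains _ _ (fun m hm hmn =>
          chains_mono (hΦ l hl m hm) _ (hh m (hA l hl m hm) hmn).1) (bd_gen_mem l hn)
      have h2 : bd (h (bd (gen l))) = u (bd (gen l)) + ε • k (bd (bd (gen l))) :=
        eqOn_chains (f := bd ∘ₗ h) (g := u + ε • (k ∘ₗ bd)) (fun m hm hmn => (hh m hm hmn).2)
          (hbdA l hl hn)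
      obtain ⟨w, hw, hbw⟩ := hac l hl (by rintro rfl; simp at hn) (n + s)
        (u (gen l) + ε • h (bd (gen l)))
        (Submodule.add_mem _ (huΦ l hl n hn) (Submodule.smul_mem _ _ h1))
        (by
          rw [map_add, map_smul, h2, bd_bd, map_zero, smul_zero, add_zero]
          exact hu l hl)
      exact ⟨w, by convert hw using 2; omega, hbw⟩)
  refine ⟨extendLin f, fun g l hl hn => ?_, fun l hl hn => ?_⟩
  · rw [extendLin_gen, extendLin_gen]
    exact hfG g l ⟨hl, hn⟩
  · rw [extendLin_gen]
    exact hf l ⟨hl, hn⟩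

/-- Equivariant acyclic carriers: the equation `∂ h = u + ε h ∂` can be solved by an equivariant
linear map `h` of degree `s` which is carried by `Φ`. -/
theorem exists_lift (hfree : ∀ (g : Γ) (p : P), g • p = p → g = 1)
    {A : Set (List P)} (hA : FaceClosed A) (hAG : ∀ (g : Γ), ∀ l ∈ A, l.map (g • ·) ∈ A)
    (Φ : List P → Set (List Q))
    (hΦ : ∀ l ∈ A, ∀ m, m.Sublist l → Φ m ⊆ Φ l)
    (hΦG : ∀ (g : Γ), ∀ l ∈ A, ∀ m ∈ Φ l, m.map (g • ·) ∈ Φ (l.map (g • ·)))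
    (hac : ∀ l ∈ A, l ≠ [] → Acyclic (Φ l)) (s : ℕ) (ε : ℝ)
    (u : Ch P →ₗ[ℝ] Ch Q)
    (huG : ∀ (g : Γ), ∀ l ∈ A, u (gen (l.map (g • ·))) = lmap (g • ·) (u (gen l)))
    (hu : ∀ l ∈ A, bd (u (gen l)) + ε • u (bd (gen l)) = 0)
    (huΦ : ∀ l ∈ A, ∀ n, l.length = n + 1 → u (gen l) ∈ chains (Φ l) (n + s))
    (h0 : Ch Q) (h0G : ∀ g : Γ, lmap (g • ·) h0 = h0) (h0Φ : h0 ∈ chains (Φ []) s)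
    (hbd0 : bd h0 = u (gen [])) :
    ∃ h : Ch P →ₗ[ℝ] Ch Q, h (gen []) = h0 ∧
      (∀ (g : Γ), ∀ l ∈ A, h (gen (l.map (g • ·))) = lmap (g • ·) (h (gen l))) ∧
      ∀ l ∈ A, h (gen l) ∈ chains (Φ l) (l.length + s) ∧
        bd (h (gen l)) = u (gen l) + ε • h (bd (gen l)) := by
  let Good : ℕ → (Ch P →ₗ[ℝ] Ch Q) → Prop := fun n h =>
    (∀ (g : Γ), ∀ l ∈ A, l.length = n →
      h (gen (l.map (g • ·))) = lmap (g • ·) (h (gen l))) ∧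
    (∀ l ∈ A, l.length = n → h (gen l) ∈ chains (Φ l) (n + s)) ∧
    ∃ k : Ch P →ₗ[ℝ] Ch Q, ∀ l ∈ A, l.length = n →
      bd (h (gen l)) = u (gen l) + ε • k (bd (gen l))
  let Rel : ℕ → (Ch P →ₗ[ℝ] Ch Q) → (Ch P →ₗ[ℝ] Ch Q) → Prop := fun n h h' =>
    ∀ l ∈ A, l.length = n + 1 → bd (h' (gen l)) = u (gen l) + ε • h (bd (gen l))
  have key : ∃ H : ℕ → (Ch P →ₗ[ℝ] Ch Q), H 0 (gen []) = h0 ∧ (∀ n, Good n (H n)) ∧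
      ∀ n, Rel n (H n) (H (n + 1)) := by
    have step : ∀ n h, Good n h → ∃ h', Good (n + 1) h' ∧ Rel n h h' := by
      rintro n h ⟨h1, h2, k, h3⟩
      obtain ⟨h', e1, e2⟩ := exists_lift_step hfree hA hAG Φ hΦ hΦG hac s ε u huG hu huΦ n h k h1
        fun l hl hn => ⟨h2 l hl hn, h3 l hl hn⟩
      exact ⟨h', ⟨e1, fun l hl hn => (e2 l hl hn).1, h, fun l hl hn => (e2 l hl hn).2⟩,
        fun l hl hn => (e2 l hl hn).2⟩
    have base : Good 0 (extendLin fun _ => h0) := by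
      refine ⟨fun g l _ _ => by simp [h0G], fun l _ hn => ?_, 0, fun l _ hn => ?_⟩
      · obtain rfl : l = [] := List.length_eq_zero_iff.1 hn
        simpa using h0Φ
      · obtain rfl : l = [] := List.length_eq_zero_iff.1 hn
        simpa using hbd0
    choose next hnext using step
    let H : ∀ n, {h // Good n h} := fun n =>
      Nat.rec ⟨_, base⟩ (fun n h => ⟨next n h.1 h.2, (hnext n h.1 h.2).1⟩) n
    exact ⟨fun n => (H n).1, by simp [H], fun n => (H n).2,
      fun n => (hnext n (H n).1 (H n).2).2⟩
  obtain ⟨H, H0, HG, HR⟩ := key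
  -- The maps are glued by length. The boundary of a list of length `n + 1` involves only lists of
  -- length `n`, so the equations survive.
  refine ⟨extendLin fun l => H l.length (gen l), by simp [H0], fun g l hl => ?_, fun l hl => ?_⟩
  · rw [extendLin_gen, extendLin_gen, List.length_map]
    exact (HG _).1 g l hl rfl
  · rw [extendLin_gen]
    refine ⟨(HG _).2.1 l hl rfl, ?_⟩
    rcases hn : l.length with _ | n
    · obtain rfl : l = [] := List.length_eq_zero_iff.1 hn
      rw [H0, hbd0, bd_nil, map_zero, smul_zero, add_zero]
    · rw [HR n l hl hn]
      congr 2
      refine eqOn_chains (B := A) (n := n) (fun m _ hm => ?_) (hA.bd_mem (gen_mem_chains hl hn))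
      rw [extendLin_gen, hm]

/-- Existence of equivariant carried chain maps. -/
theorem exists_chainMap (hfree : ∀ (g : Γ) (p : P), g • p = p → g = 1)
    {A : Set (List P)} (hA : FaceClosed A) (hAG : ∀ (g : Γ), ∀ l ∈ A, l.map (g • ·) ∈ A)
    (Φ : List P → Set (List Q))
    (hΦ : ∀ l ∈ A, ∀ m, m.Sublist l → Φ m ⊆ Φ l) (hnil : [] ∈ Φ [])
    (hΦG : ∀ (g : Γ), ∀ l ∈ A, ∀ m ∈ Φ l, m.map (g • ·) ∈ Φ (l.map (g • ·)))
    (hac : ∀ l ∈ A, l ≠ [] → Acyclic (Φ l)) :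
    ∃ f : Ch P →ₗ[ℝ] Ch Q, f (gen []) = gen [] ∧
      (∀ (g : Γ), ∀ l ∈ A, f (gen (l.map (g • ·))) = lmap (g • ·) (f (gen l))) ∧
      ∀ l ∈ A, f (gen l) ∈ chains (Φ l) l.length ∧ bd (f (gen l)) = f (bd (gen l)) := by
  -- A chain map is a solution of degree `0` with `ε = 1` and `u = 0`.
  obtain ⟨f, h0, hG, hf⟩ := exists_lift hfree hA hAG Φ hΦ hΦG hac 0 1 0 (by simp) (by simp)
    (fun l _ n _ => Submodule.zero_mem _) (gen []) (by simp) (gen_mem_chains hnil rfl) (by simp)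
  exact ⟨f, h0, hG, fun l hl => by simpa using hf l hl⟩

/-- Existence of equivariant carried chain homotopies. -/
theorem exists_chainHomotopy (hfree : ∀ (g : Γ) (p : P), g • p = p → g = 1)
    {A : Set (List P)} (hA : FaceClosed A) (hAG : ∀ (g : Γ), ∀ l ∈ A, l.map (g • ·) ∈ A)
    (Φ : List P → Set (List Q))
    (hΦ : ∀ l ∈ A, ∀ m, m.Sublist l → Φ m ⊆ Φ l)
    (hΦG : ∀ (g : Γ), ∀ l ∈ A, ∀ m ∈ Φ l, m.map (g • ·) ∈ Φ (l.map (g • ·)))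
    (hac : ∀ l ∈ A, l ≠ [] → Acyclic (Φ l)) (a b : Ch P →ₗ[ℝ] Ch Q)
    (hnil : a (gen []) = b (gen []))
    (haG : ∀ (g : Γ), ∀ l ∈ A, a (gen (l.map (g • ·))) = lmap (g • ·) (a (gen l)))
    (hbG : ∀ (g : Γ), ∀ l ∈ A, b (gen (l.map (g • ·))) = lmap (g • ·) (b (gen l)))
    (haΦ : ∀ l ∈ A, a (gen l) ∈ chains (Φ l) l.length)
    (hbΦ : ∀ l ∈ A, b (gen l) ∈ chains (Φ l) l.length)
    (ha : ∀ l ∈ A, bd (a (gen l)) = a (bd (gen l)))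
    (hb : ∀ l ∈ A, bd (b (gen l)) = b (bd (gen l))) :
    ∃ h : Ch P →ₗ[ℝ] Ch Q, h (gen []) = 0 ∧
      (∀ (g : Γ), ∀ l ∈ A, h (gen (l.map (g • ·))) = lmap (g • ·) (h (gen l))) ∧
      ∀ l ∈ A, h (gen l) ∈ chains (Φ l) (l.length + 1) ∧
        bd (h (gen l)) + h (bd (gen l)) = a (gen l) - b (gen l) := by
  -- A homotopy is a solution of degree `1` with `ε = -1` and `u = a - b`, starting from `0` on the
  -- empty list.
  obtain ⟨h, h0, hG, hh⟩ := exists_lift hfree hA hAG Φ hΦ hΦG hac 1 (-1) (a - b)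
    (fun g l hl => by simp [haG g l hl, hbG g l hl]) (fun l hl => by simp [ha l hl, hb l hl])
    (fun l hl n hn => by
      rw [← hn]
      exact Submodule.sub_mem _ (haΦ l hl) (hbΦ l hl))
    0 (by simp) (Submodule.zero_mem _) (by simp [hnil])
  refine ⟨h, h0, hG, fun l hl => ⟨(hh l hl).1, ?_⟩⟩
  rw [(hh l hl).2]
  simp

end Lift

/-- The trivial action of the trivial group. -/
@[reducible] def trivialAction (P : Type*) : MulAction Unit P where
  smul _ x := x
  one_smul _ := rfl
  mul_smul _ _ _ := rfl

/-- Existence of carried chain maps. -/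
theorem exists_chainMap_of_acyclic {A : Set (List P)} (hA : FaceClosed A)
    (Φ : List P → Set (List Q))
    (hΦ : ∀ l ∈ A, ∀ m, m.Sublist l → Φ m ⊆ Φ l) (hnil : [] ∈ Φ [])
    (hac : ∀ l ∈ A, l ≠ [] → Acyclic (Φ l)) :
    ∃ f : Ch P →ₗ[ℝ] Ch Q, f (gen []) = gen [] ∧
      ∀ l ∈ A, f (gen l) ∈ chains (Φ l) l.length ∧ bd (f (gen l)) = f (bd (gen l)) := by
  let := trivialAction P
  let := trivialAction Q
  have e : ∀ (R : Type _) (l : List R), l.map (fun x => x) = l := fun R l => by simp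
  -- The one-element group acts freely on any set, so the equivariant statement specializes.
  obtain ⟨f, h0, -, hf⟩ := exists_chainMap (Γ := Unit) (fun _ _ _ => rfl) hA
    (fun _ l hl => (e P l).symm ▸ hl) Φ hΦ hnil
    (fun _ l _ m hm => by
      change m.map (fun x => x) ∈ Φ (l.map (fun x => x))
      simpa using hm) hac
  exact ⟨f, h0, hf⟩

/-- Existence of carried chain homotopies. -/
theorem exists_chainHomotopy_of_acyclic {A : Set (List P)} (hA : FaceClosed A)
    (Φ : List P → Set (List Q)) (hΦ : ∀ l ∈ A, ∀ m, m.Sublist l → Φ m ⊆ Φ l)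
    (hac : ∀ l ∈ A, l ≠ [] → Acyclic (Φ l)) (a b : Ch P →ₗ[ℝ] Ch Q)
    (hnil : a (gen []) = b (gen []))
    (haΦ : ∀ l ∈ A, a (gen l) ∈ chains (Φ l) l.length)
    (hbΦ : ∀ l ∈ A, b (gen l) ∈ chains (Φ l) l.length)
    (ha : ∀ l ∈ A, bd (a (gen l)) = a (bd (gen l)))
    (hb : ∀ l ∈ A, bd (b (gen l)) = b (bd (gen l))) :
    ∃ h : Ch P →ₗ[ℝ] Ch Q, ∀ l ∈ A, h (gen l) ∈ chains (Φ l) (l.length + 1) ∧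
        bd (h (gen l)) + h (bd (gen l)) = a (gen l) - b (gen l) := by
  let := trivialAction P
  let := trivialAction Q
  have e : ∀ (R : Type _) (l : List R), l.map (fun x => x) = l := fun R l => by simp
  have e' : ∀ c : Ch P →ₗ[ℝ] Ch Q, ∀ l : List P, c (gen (l.map fun x => x)) =
      lmap (fun x => x) (c (gen l)) := fun c l => by
    rw [e]
    exact (lmap_id _).symm
  obtain ⟨h, -, -, hh⟩ := exists_chainHomotopy (Γ := Unit) (fun _ _ _ => rfl) hA
    (fun _ l hl => (e P l).symm ▸ hl) Φ hΦ
    (fun _ l _ m hm => by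
      change m.map (fun x => x) ∈ Φ (l.map (fun x => x))
      simpa using hm) hac a b hnil (fun _ l _ => e' a l) (fun _ l _ => e' b l) haΦ hbΦ ha hb
  exact ⟨h, hh⟩

/-- Homologous images of a cycle under contiguous vertex maps. -/
theorem exists_bd_eq_lmap_sub_lmap {A : Set (List P)} (hA : FaceClosed A) (B : Set (List Q))
    (f g : P → Q) (hfg : ∀ l ∈ A, listsIn {x | x ∈ l.map f ++ l.map g} ⊆ B) {n : ℕ} {z : Ch P}
    (hz : z ∈ chains A n) (hbd : bd z = 0) :
    ∃ w ∈ chains B (n + 1), bd w = lmap f z - lmap g z := by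
  have hmem : ∀ (k : P → Q) (l : List P), (∀ x ∈ l.map k, x ∈ l.map f ++ l.map g) →
      lmap k (gen l) ∈ chains (listsIn {x | x ∈ l.map f ++ l.map g}) l.length := fun k l hk => by
    rw [lmap_gen]
    exact gen_mem_chains (fun x hx => hk x hx) (by simp)
  -- The carrier of `l` is the full simplex on the vertices of `f(l)` and `g(l)` together; a cone
  -- contracts it.
  obtain ⟨h, hh⟩ := exists_chainHomotopy_of_acyclic hA
    (fun l => listsIn {x | x ∈ l.map f ++ l.map g})
    (fun l _ m hm => listsIn_mono fun x hx =>
      ((hm.map f).append (hm.map g)).subset hx)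
    (fun l _ hl => by
      obtain ⟨a, l, rfl⟩ := List.exists_cons_of_ne_nil hl
      exact acyclic_listsIn (a := f a) (by simp))
    (lmap f) (lmap g) (by simp)
    (fun l _ => hmem f l fun x hx => List.mem_append_left _ hx)
    (fun l _ => hmem g l fun x hx => List.mem_append_right _ hx)
    (fun l _ => bd_lmap _ _) (fun l _ => bd_lmap _ _)
  refine ⟨h z, map_mem_of_mem_chains _ _ (fun l hl hn => ?_) hz, ?_⟩
  · rw [← hn]
    exact chains_mono (hfg l hl) _ (hh l hl).1
  · have := eqOn_chains (f := bd ∘ₗ h + h ∘ₗ bd) (g := lmap f - lmap g)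
      (fun l hl _ => (hh l hl).2) hz
    simpa [hbd] using this

end

noncomputable section

variable {P Q : Type*} {M M' : Type*} [AddCommGroup M] [Module ℝ M] [AddCommGroup M'] [Module ℝ M']

/-! ### Alternation of chains -/

/-- The signed sum over the entries `a` of a list of the values of `F a` on the list without `a`. -/
def extractList (F : P → Ch P →ₗ[ℝ] M) : List P → M
  | [] => 0
  | a :: l => F a (gen l) - extractList (fun b => F b ∘ₗ cone a) l

/-- The linear extension of `extractList`. -/
def extract (F : P → Ch P →ₗ[ℝ] M) : Ch P →ₗ[ℝ] M := extendLin (extractList F)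

@[simp] theorem extract_nil (F : P → Ch P →ₗ[ℝ] M) : extract F (gen []) = 0 := by
  simp [extract, extractList]

@[simp] theorem extract_cons (F : P → Ch P →ₗ[ℝ] M) (a : P) (l : List P) :
    extract F (gen (a :: l)) = F a (gen l) - extract (fun b => F b ∘ₗ cone a) (gen l) := by
  simp [extract, extractList]

theorem extract_cone (F : P → Ch P →ₗ[ℝ] M) (a : P) (z : Ch P) :
    extract F (cone a z) = F a z - extract (fun b => F b ∘ₗ cone a) z := by
  have : extract F ∘ₗ cone a = F a - extract (fun b => F b ∘ₗ cone a) := Ch.hom_ext fun l => by simp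
  exact LinearMap.congr_fun this z

theorem extract_sub (F F' : P → Ch P →ₗ[ℝ] M) (z : Ch P) :
    extract (fun b => F b - F' b) z = extract F z - extract F' z := by
  have : extract (fun b => F b - F' b) = extract F - extract F' := by
    refine Ch.hom_ext fun l => ?_
    induction l generalizing F F' with
    | nil => simp
    | cons a l ih =>
      have := ih (fun b => F b ∘ₗ cone a) (fun b => F' b ∘ₗ cone a)
      simp only [extract_cons, LinearMap.sub_apply, LinearMap.sub_comp] at this ⊢
      rw [this]
      abel
  exact LinearMap.congr_fun this z

theorem map_extract (c : M →ₗ[ℝ] M') (F : P → Ch P →ₗ[ℝ] M) (z : Ch P) :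
    extract (fun b => c ∘ₗ F b) z = c (extract F z) := by
  have : extract (fun b => c ∘ₗ F b) = c ∘ₗ extract F := by
    refine Ch.hom_ext fun l => ?_
    induction l generalizing F with
    | nil => simp
    | cons a l ih =>
      have := ih (fun b => F b ∘ₗ cone a)
      simp only [extract_cons, LinearMap.comp_apply, map_sub, ← LinearMap.comp_assoc] at this ⊢
      rw [this]
  exact LinearMap.congr_fun this z

theorem extract_congr {F F' : P → Ch P →ₗ[ℝ] M} {l : List P}
    (h : ∀ b m, m.length + 1 = l.length → F b (gen m) = F' b (gen m)) :
    extract F (gen l) = extract F' (gen l) := by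
  induction l generalizing F F' with
  | nil => simp
  | cons a l ih =>
    rw [extract_cons, extract_cons, h a l rfl]
    congr 1
    refine ih fun b m hm => ?_
    simpa using h b (a :: m) (by simp [hm])

theorem extract_id (z : Ch P) : extract (fun _ : P => LinearMap.id) z = bd z := by
  have : extract (fun _ : P => LinearMap.id) = (bd : Ch P →ₗ[ℝ] Ch P) := by
    refine Ch.hom_ext fun l => ?_
    induction l with
    | nil => simp
    | cons a l ih =>
      rw [extract_cons, bd_cons]
      congr 1
      rw [← ih, ← map_extract]
      rfl
  exact LinearMap.congr_fun this z

/-- Both sides remove two entries, in opposite orders. Reversing the order shifts exactly one of the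
two positions by one, hence the sign. -/
theorem extract_comp_bd (F : P → Ch P →ₗ[ℝ] M) (z : Ch P) :
    extract (fun b => F b ∘ₗ bd) z = - extract F (bd z) := by
  have : extract (fun b => F b ∘ₗ bd) = - (extract F ∘ₗ bd) := by
    refine Ch.hom_ext fun l => ?_
    induction l generalizing F with
    | nil => simp
    | cons a l ih =>
      have e : (fun b => (F b ∘ₗ bd) ∘ₗ cone a) = fun b => F b - (F b ∘ₗ cone a) ∘ₗ bd := by
        funext b
        refine LinearMap.ext fun z => ?_
        simp [bd_cone]
      have := ih (fun b => F b ∘ₗ cone a)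
      simp only [extract_cons, e, extract_sub, this, LinearMap.neg_apply, LinearMap.comp_apply,
        bd_cons, map_sub, extract_cone]
      abel
  exact LinearMap.congr_fun this z

theorem extract_lmap (F : Q → Ch Q →ₗ[ℝ] M) (f : P → Q) (z : Ch P) :
    extract F (lmap f z) = extract (fun b => F (f b) ∘ₗ lmap f) z := by
  have : extract F ∘ₗ lmap f = extract (fun b => F (f b) ∘ₗ lmap f) := by
    refine Ch.hom_ext fun l => ?_
    induction l generalizing F with
    | nil => simp
    | cons a l ih =>
      have e : (fun b => (F (f b) ∘ₗ lmap f) ∘ₗ cone a) =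
          fun b => (F (f b) ∘ₗ cone (f a)) ∘ₗ lmap f := by
        funext b
        refine LinearMap.ext fun z => ?_
        simp [lmap_cone]
      have := ih (fun b => F b ∘ₗ cone (f a))
      simp only [LinearMap.comp_apply, lmap_gen, List.map_cons, extract_cons, e] at this ⊢
      rw [this]
  exact LinearMap.congr_fun this z

theorem extract_mem (W : Submodule ℝ M) (U : Set P) {n : ℕ} {F : P → Ch P →ₗ[ℝ] M}
    (h : ∀ b ∈ U, ∀ z ∈ chains (listsIn U) n, F b z ∈ W) {l : List P} (hl : l ∈ listsIn U)
    (hn : l.length = n + 1) : extract F (gen l) ∈ W := by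
  induction l generalizing F n with
  | nil => simp
  | cons a l ih =>
    have hU : ∀ m ∈ listsIn U, a :: m ∈ listsIn U := fun m hm x hx => by
      rcases List.mem_cons.1 hx with rfl | hx
      exacts [hl _ (by simp), hm x hx]
    have hl' : l ∈ listsIn U := fun x hx => hl x (by simp [hx])
    rw [extract_cons]
    refine Submodule.sub_mem _ (h a (hl a (by simp)) _ (gen_mem_chains hl' (by simpa using hn))) ?_
    rcases n with _ | n
    · obtain rfl : l = [] := by simpa using hn
      simp
    · exact ih (fun b hb z hz => h b hb _ (cone_mem_chains hU hz)) hl' (by simpa using hn)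

/-- The list with the entries at `i` and `i + 1` exchanged. -/
def swapAt : ℕ → List P → List P
  | 0, a :: b :: l => b :: a :: l
  | i + 1, a :: l => a :: swapAt i l
  | _, l => l

@[simp] theorem swapAt_zero (a b : P) (l : List P) : swapAt 0 (a :: b :: l) = b :: a :: l := rfl

@[simp] theorem swapAt_succ (i : ℕ) (a : P) (l : List P) :
    swapAt (i + 1) (a :: l) = a :: swapAt i l := rfl

/-- A linear map on chains is alternating if it changes sign when two adjacent entries of a list
are exchanged. -/
def IsAlt (F : Ch P →ₗ[ℝ] M) : Prop :=
  ∀ (l : List P) (i : ℕ), i + 1 < l.length → F (gen l) + F (gen (swapAt i l)) = 0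

theorem IsAlt.comp_cone {F : Ch P →ₗ[ℝ] M} (hF : IsAlt F) (a : P) : IsAlt (F ∘ₗ cone a) :=
  fun l i hi => by simpa using hF (a :: l) (i + 1) (by simpa using hi)

theorem IsAlt.map_comp {F : Ch P →ₗ[ℝ] M} (hF : IsAlt F) (c : M →ₗ[ℝ] M') : IsAlt (c ∘ₗ F) :=
  fun l i hi => by simp [← map_add, hF l i hi]

theorem IsAlt.cone_cone {F : Ch P →ₗ[ℝ] M} (hF : IsAlt F) (a b : P) (z : Ch P) :
    F (cone a (cone b z)) = - F (cone b (cone a z)) := by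
  have : F ∘ₗ cone a ∘ₗ cone b = - (F ∘ₗ cone b ∘ₗ cone a) := by
    refine Ch.hom_ext fun l => ?_
    simpa [eq_neg_iff_add_eq_zero] using hF (a :: b :: l) 0 (by simp)
  exact LinearMap.congr_fun this z

/-- If neither exchanged entry is extracted, the sign comes from `F b`. If one of them is, the
remaining lists agree before and after the exchange, and extraction at adjacent positions has
opposite signs. -/
theorem IsAlt.extract {F : P → Ch P →ₗ[ℝ] M} (hF : ∀ b, IsAlt (F b)) : IsAlt (extract F) := by
  intro l i hi
  induction i generalizing l F with
  | zero =>
    obtain ⟨a, b, l, rfl⟩ : ∃ a b m, l = a :: b :: m := by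
      rcases l with _ | ⟨a, _ | ⟨b, m⟩⟩
      · simp at hi
      · simp at hi
      · exact ⟨a, b, m, rfl⟩
    have e : (fun c => (F c ∘ₗ cone a) ∘ₗ cone b) =
        fun c => (-LinearMap.id) ∘ₗ ((F c ∘ₗ cone b) ∘ₗ cone a) := by
      funext c
      refine LinearMap.ext fun z => ?_
      simpa using (hF c).cone_cone a b z
    simp only [swapAt_zero, extract_cons, LinearMap.comp_apply, cone_gen]
    rw [e, map_extract]
    simp
    abel
  | succ i ih =>
    rcases l with _ | ⟨a, l⟩
    · simp at hi
    have hi' : i + 1 < l.length := by simpa using hi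
    have h1 := ih (F := fun b => F b ∘ₗ cone a) (fun b => (hF b).comp_cone a) l hi'
    have h2 := hF a l i hi'
    simp only [swapAt_succ, extract_cons]
    rw [sub_add_sub_comm, h1, h2, sub_zero]

theorem IsAlt.comp_bd {F : Ch P →ₗ[ℝ] M} (hF : IsAlt F) : IsAlt (F ∘ₗ bd) := by
  have : F ∘ₗ bd = OrliczCohomology.extract (fun _ : P => F) := by
    refine LinearMap.ext fun z => ?_
    rw [LinearMap.comp_apply, ← extract_id, ← map_extract]
    rfl
  rw [this]
  exact IsAlt.extract fun _ => hF

/-- The signed sum of the reorderings of a list of length `n`; lists of other lengths are sent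
to `0`. -/
def altSum : ℕ → Ch P →ₗ[ℝ] Ch P
  | 0 => extendLin fun l => match l with
    | [] => gen []
    | _ :: _ => 0
  | n + 1 => extract fun b => cone b ∘ₗ altSum n

@[simp] theorem altSum_zero_nil : altSum 0 (gen ([] : List P)) = gen [] := by simp [altSum]

@[simp] theorem altSum_zero_cons (a : P) (l : List P) : altSum 0 (gen (a :: l)) = 0 := by
  simp [altSum]

/-- In the boundary of `cone b ∘ altSum n`, the part deleting the apex `b` contributes `altSum n ∘
∂` once. The other part contributes it `n` more times, by induction and the anticommutation
`extract_comp_bd`. The factor `n + 1` is what the normalization of `alt` by factorials absorbs. -/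
theorem bd_altSum (n : ℕ) (z : Ch P) :
    bd (altSum (n + 1) z) = ((n : ℝ) + 1) • altSum n (bd z) := by
  have key : ∀ n (z : Ch P), bd (altSum (n + 1) z) =
      altSum n (bd z) - extract (fun b => cone b ∘ₗ bd ∘ₗ altSum n) z := by
    intro n z
    have e : (fun b : P => bd ∘ₗ cone b ∘ₗ altSum n) =
        fun b => altSum n ∘ₗ LinearMap.id - cone b ∘ₗ bd ∘ₗ altSum n := by
      funext b
      refine LinearMap.ext fun z => ?_
      simp [bd_cone]
    rw [altSum, ← map_extract, e, extract_sub, map_extract, extract_id]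
  induction n generalizing z with
  | zero =>
    have e : (bd ∘ₗ altSum 0 : Ch P →ₗ[ℝ] Ch P) = 0 := Ch.hom_ext fun l => by cases l <;> simp
    rw [key]
    simp only [e, LinearMap.comp_zero]
    have := map_extract (P := P) (0 : Ch P →ₗ[ℝ] Ch P) (fun _ => 0) z
    simp only [LinearMap.comp_zero, LinearMap.zero_apply] at this
    simp [this]
  | succ n ih =>
    have e : (fun b : P => cone b ∘ₗ bd ∘ₗ altSum (n + 1)) =
        fun b => (((n : ℝ) + 1) • LinearMap.id) ∘ₗ (cone b ∘ₗ altSum n) ∘ₗ bd := by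
      funext b
      refine LinearMap.ext fun z => ?_
      simp [ih]
    rw [key, e, map_extract, extract_comp_bd]
    change _ - ((n : ℝ) + 1) • (- altSum (n + 1) (bd z)) = _
    push_cast
    module

theorem isAlt_altSum (n : ℕ) : IsAlt (altSum n : Ch P →ₗ[ℝ] Ch P) := by
  induction n with
  | zero =>
    intro l i hi
    rcases l with _ | ⟨a, _ | ⟨b, l⟩⟩
    · simp at hi
    · simp at hi
    · rcases i with _ | i <;> simp
  | succ n ih => exact IsAlt.extract fun b => ih.map_comp _

/-- The sign of extracting an entry is the sign of moving it to the front, so the two cancel and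
every entry contributes `F (gen l)` once. -/
theorem IsAlt.extract_cone {F : Ch P →ₗ[ℝ] M} (hF : IsAlt F) (l : List P) :
    OrliczCohomology.extract (fun b => F ∘ₗ cone b) (gen l) = (l.length : ℝ) • F (gen l) := by
  induction l generalizing F with
  | nil => simp
  | cons a l ih =>
    have e : (fun b => (F ∘ₗ cone b) ∘ₗ cone a) =
        fun b => (-LinearMap.id) ∘ₗ ((F ∘ₗ cone a) ∘ₗ cone b) := by
      funext b
      refine LinearMap.ext fun z => ?_
      simpa using hF.cone_cone b a z
    rw [extract_cons, e, map_extract, ih (hF.comp_cone a)]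
    simp
    module

theorem IsAlt.apply_altSum {F : Ch P →ₗ[ℝ] M} (hF : IsAlt F) (l : List P) :
    F (altSum l.length (gen l)) = (l.length.factorial : ℝ) • F (gen l) := by
  generalize hn : l.length = n
  induction n generalizing F l with
  | zero =>
    obtain rfl : l = [] := List.length_eq_zero_iff.1 hn
    simp
  | succ n ih =>
    have e : OrliczCohomology.extract (fun b => F ∘ₗ cone b ∘ₗ altSum n) (gen l) =
        OrliczCohomology.extract (fun b => ((n.factorial : ℝ) • LinearMap.id) ∘ₗ F ∘ₗ cone b)
          (gen l) :=
      extract_congr fun b m hm => by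
        simpa using ih (hF.comp_cone b) m (by omega)
    rw [altSum, ← map_extract, e, map_extract, hF.extract_cone, hn, Nat.factorial_succ]
    simp only [LinearMap.smul_apply, LinearMap.id_apply, smul_smul]
    push_cast
    ring_nf

theorem altSum_lmap (n : ℕ) (f : P → Q) (z : Ch P) :
    altSum n (lmap f z) = lmap f (altSum n z) := by
  induction n generalizing z with
  | zero =>
    have : altSum 0 ∘ₗ lmap f = lmap f ∘ₗ altSum 0 := Ch.hom_ext fun l => by cases l <;> simp
    exact LinearMap.congr_fun this z
  | succ n ih =>
    rw [altSum, extract_lmap, altSum, ← map_extract]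
    congr 2
    funext b
    refine LinearMap.ext fun z => ?_
    simp [ih, lmap_cone]

theorem altSum_mem (U : Set P) (n : ℕ) {z : Ch P} (hz : z ∈ chains (listsIn U) n) :
    altSum n z ∈ chains (listsIn U) n := by
  induction n generalizing z with
  | zero =>
    refine map_mem_of_mem_chains _ _ (fun l hl hn => ?_) hz
    obtain rfl : l = [] := List.length_eq_zero_iff.1 hn
    rw [altSum_zero_nil]
    exact gen_mem_chains hl rfl
  | succ n ih =>
    refine map_mem_of_mem_chains _ _ (fun l hl hn => ?_) hz
    refine extract_mem _ U (fun b hb z hz => ?_) hl hn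
    refine cone_mem_chains (fun l hl x hx => ?_) (ih hz)
    rcases List.mem_cons.1 hx with rfl | hx
    exacts [hb, hl x hx]

/-- The alternation operator, an idempotent chain map. -/
def alt : Ch P →ₗ[ℝ] Ch P :=
  extendLin fun l => (l.length.factorial : ℝ)⁻¹ • altSum l.length (gen l)

theorem alt_gen (l : List P) :
    alt (gen l) = (l.length.factorial : ℝ)⁻¹ • altSum l.length (gen l) := extendLin_gen _ _

theorem alt_nil : alt (gen ([] : List P)) = gen [] := by simp [alt_gen]

theorem length_swapAt (i : ℕ) (l : List P) : (swapAt i l).length = l.length := by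
  induction i generalizing l with
  | zero => rcases l with _ | ⟨a, _ | ⟨b, l⟩⟩ <;> simp [swapAt]
  | succ i ih => rcases l with _ | ⟨a, l⟩ <;> simp [swapAt, ih]

theorem isAlt_alt : IsAlt (alt : Ch P →ₗ[ℝ] Ch P) := fun l i hi => by
  rw [alt_gen, alt_gen, length_swapAt, ← smul_add, isAlt_altSum _ l i hi, smul_zero]

/-- This is why a homotopy to `alt` is as good as a homotopy to the identity once it is evaluated on
alternating cochains. -/
theorem IsAlt.apply_alt {F : Ch P →ₗ[ℝ] M} (hF : IsAlt F) (z : Ch P) : F (alt z) = F z := by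
  have : F ∘ₗ alt = F := Ch.hom_ext fun l => by
    rw [LinearMap.comp_apply, alt_gen, map_smul, hF.apply_altSum, smul_smul,
      inv_mul_cancel₀ (by positivity), one_smul]
  exact LinearMap.congr_fun this z

theorem bd_alt (z : Ch P) : bd (alt z) = alt (bd z) := by
  have : (bd ∘ₗ alt : Ch P →ₗ[ℝ] Ch P) = alt ∘ₗ bd := Ch.hom_ext fun l => by
    rw [LinearMap.comp_apply, LinearMap.comp_apply, alt_gen]
    rcases hn : l.length with _ | n
    · obtain rfl : l = [] := List.length_eq_zero_iff.1 hn
      simp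
    · have h : alt (bd (gen l)) = (n.factorial : ℝ)⁻¹ • altSum n (bd (gen l)) :=
        eqOn_chains (f := alt) (g := (n.factorial : ℝ)⁻¹ • altSum n)
          (fun m _ hm => (alt_gen m).trans (by rw [hm]; rfl)) (bd_gen_mem l hn)
      rw [h, map_smul, bd_altSum, smul_smul, Nat.factorial_succ]
      congr 1
      push_cast
      field_simp
  exact LinearMap.congr_fun this z

theorem alt_lmap (f : P → Q) (z : Ch P) : alt (lmap f z) = lmap f (alt z) := by
  have : alt ∘ₗ lmap f = lmap f ∘ₗ alt := Ch.hom_ext fun l => by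
    rw [LinearMap.comp_apply, LinearMap.comp_apply, lmap_gen, alt_gen, alt_gen, map_smul,
      ← altSum_lmap, lmap_gen, List.length_map]
  exact LinearMap.congr_fun this z

theorem alt_gen_mem {U : Set P} {l : List P} (hl : l ∈ listsIn U) :
    alt (gen l) ∈ chains (listsIn U) l.length := by
  rw [alt_gen]
  exact Submodule.smul_mem _ _ (altSum_mem U _ (gen_mem_chains hl rfl))

end

noncomputable section

open Filter Topology

variable {V : Type*}

/-! ### Fine chains in convex sets -/

/-- The lists of points of `C` of diameter less than `δ` in the supremum distance. -/
def smallLists (C : Set (V → ℝ)) (δ : ℝ) : Set (List (V → ℝ)) :=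
  {l | l ∈ listsIn C ∧ ∃ η < δ, ∀ p ∈ l, ∀ q ∈ l, ∀ v, |p v - q v| ≤ η}

theorem smallLists_mono {C D : Set (V → ℝ)} (h : C ⊆ D) (δ : ℝ) :
    smallLists C δ ⊆ smallLists D δ :=
  fun _ hl => ⟨listsIn_mono h hl.1, hl.2⟩

/-- The homothety with centre `c` and ratio `1 - s`. -/
def shrink (c : V → ℝ) (s : ℝ) (p : V → ℝ) : V → ℝ := fun v => (1 - s) * p v + s * c v

theorem shrink_iterate_sub_le {c p : V → ℝ} {s : ℝ} (hs : s ≤ 1)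
    (hp : ∀ v, |p v - c v| ≤ 1) (j : ℕ) (v : V) :
    |(shrink c s)^[j] p v - c v| ≤ (1 - s) ^ j := by
  induction j with
  | zero => simpa using hp v
  | succ j ih =>
    rw [Function.iterate_succ_apply', pow_succ']
    have : shrink c s ((shrink c s)^[j] p) v - c v =
        (1 - s) * ((shrink c s)^[j] p v - c v) := by
      simp only [shrink]
      ring
    rw [this, abs_mul, abs_of_nonneg (by linarith)]
    exact mul_le_mul_of_nonneg_left ih (by linarith)

/-- Each list has its own bound below `δ`, and a chain involves only finitely many lists. -/
theorem exists_uniform_bound (C : Set (V → ℝ)) {δ : ℝ} {n : ℕ} {z : Ch (V → ℝ)}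
    (hz : z ∈ chains (smallLists C δ) n) : ∃ η < δ,
      z ∈ chains {l | l ∈ listsIn C ∧ ∀ p ∈ l, ∀ q ∈ l, ∀ v, |p v - q v| ≤ η} n := by
  have h : ∀ᶠ η in 𝓝[<] δ, ∀ l ∈ z.support, ∀ p ∈ l, ∀ q ∈ l, ∀ v, |p v - q v| ≤ η := by
    rw [eventually_all_finset]
    intro l hl
    obtain ⟨-, η, hη, hle⟩ := (hz hl).1
    filter_upwards [Ioo_mem_nhdsLT hη] with ε hε p hp q hq v
    exact (hle p hp q hq v).trans hε.1.le
  obtain ⟨η, h1, h2⟩ := (h.and self_mem_nhdsWithin).exists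
  exact ⟨η, h2, fun l hl => ⟨⟨(hz hl).1.1, h1 l hl⟩, (hz hl).2⟩⟩

/-- A cone over a fine cycle need not be fine. The cycle is instead shrunk towards `c` in many small
steps; consecutive stages are close enough to be joined by a fine homotopy. Once the cycle is within
`δ / 2` of `c`, the cone with apex `c` is fine. This replaces iterated barycentric subdivision. -/
theorem acyclic_smallLists {C : Set (V → ℝ)} {c : V → ℝ} (hc : c ∈ C)
    (hconv : ∀ p ∈ C, ∀ s, 0 ≤ s → s ≤ 1 → shrink c s p ∈ C)
    (hbdd : ∀ p ∈ C, ∀ v, |p v - c v| ≤ 1) {δ : ℝ} (hδ : 0 < δ) :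
    Acyclic (smallLists C δ) := by
  intro n z hz hbd
  obtain ⟨η, hη, hz'⟩ := exists_uniform_bound C hz
  set A : Set (List (V → ℝ)) :=
    {l | l ∈ listsIn C ∧ ∀ p ∈ l, ∀ q ∈ l, ∀ v, |p v - q v| ≤ η} with hA
  -- One step moves points by at most `s`, so a list and its image together have diameter at most `η
  -- + s`, which must stay below `δ`.
  set s : ℝ := min 1 ((δ - η) / 2) with hs
  have hs0 : 0 < s := lt_min one_pos (by linarith)
  have hs1 : s ≤ 1 := min_le_left _ _
  have hs2 : s ≤ (δ - η) / 2 := min_le_right _ _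
  have hAcl : FaceClosed A := fun l hl m hm =>
    ⟨fun x hx => hl.1 x (hm.subset hx),
      fun p hp q hq => hl.2 p (hm.subset hp) q (hm.subset hq)⟩
  have hshr : ∀ (p q : V → ℝ) (v : V), |p v - q v| ≤ η → |shrink c s p v - shrink c s q v| ≤ η := by
    intro p q v h
    have : shrink c s p v - shrink c s q v = (1 - s) * (p v - q v) := by
      simp only [shrink]
      ring
    rw [this, abs_mul, abs_of_nonneg (by linarith)]
    nlinarith [abs_nonneg (p v - q v)]
  have hshr' : ∀ p : V → ℝ, ∀ q ∈ C, ∀ v, |p v - q v| ≤ η → |p v - shrink c s q v| ≤ η + s := by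
    intro p q hq v h
    have : p v - shrink c s q v = (p v - q v) + s * (q v - c v) := by
      simp only [shrink]
      ring
    rw [this]
    refine (abs_add_le _ _).trans (add_le_add h ?_)
    rw [abs_mul, abs_of_pos hs0]
    nlinarith [hbdd q hq v]
  have hAmap : ∀ l ∈ A, l.map (shrink c s) ∈ A := by
    refine fun l hl => ⟨fun x hx => ?_, fun p hp q hq v => ?_⟩
    · obtain ⟨p, hp, rfl⟩ := List.mem_map.1 hx
      exact hconv p (hl.1 p hp) s hs0.le hs1
    · obtain ⟨p', hp', rfl⟩ := List.mem_map.1 hp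
      obtain ⟨q', hq', rfl⟩ := List.mem_map.1 hq
      exact hshr p' q' v (hl.2 p' hp' q' hq' v)
  have hstep : ∀ l ∈ A, listsIn {x | x ∈ l.map id ++ l.map (shrink c s)} ⊆ smallLists C δ := by
    intro l hl m hm
    have hm' : ∀ x ∈ m, x ∈ l ∨ ∃ y ∈ l, shrink c s y = x := fun x hx => by
      simpa using hm x hx
    refine ⟨fun x hx => ?_, η + s, by linarith, fun p hp q hq v => ?_⟩
    · rcases hm' x hx with h | ⟨y, hy, rfl⟩
      exacts [hl.1 x h, hconv y (hl.1 y hy) s hs0.le hs1]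
    · rcases hm' p hp with hp' | ⟨p', hp', rfl⟩ <;> rcases hm' q hq with hq' | ⟨q', hq', rfl⟩
      · linarith [hl.2 p hp' q hq' v]
      · exact hshr' p q' (hl.1 q' hq') v (hl.2 p hp' q' hq' v)
      · rw [abs_sub_comm]
        exact hshr' q p' (hl.1 p' hp') v (hl.2 q hq' p' hp' v)
      · linarith [hshr p' q' v (hl.2 p' hp' q' hq' v)]
  have hiter : ∀ j : ℕ, lmap (shrink c s)^[j] z ∈ chains A n ∧
      ∃ w ∈ chains (smallLists C δ) (n + 1), bd w = z - lmap (shrink c s)^[j] z := by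
    intro j
    induction j with
    | zero =>
      have : lmap (shrink c s)^[0] z = z := lmap_id z
      refine ⟨by rwa [this], 0, Submodule.zero_mem _, ?_⟩
      rw [this, map_zero, sub_self]
    | succ j ih =>
      obtain ⟨h1, w, hw, hbw⟩ := ih
      have e : lmap (shrink c s)^[j + 1] z = lmap (shrink c s) (lmap (shrink c s)^[j] z) := by
        rw [lmap_lmap, Function.iterate_succ']
      rw [e]
      refine ⟨lmap_mem_chains hAmap h1, ?_⟩
      obtain ⟨w', hw', hbw'⟩ := exists_bd_eq_lmap_sub_lmap hAcl _ id (shrink c s) hstep h1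
        (by rw [bd_lmap, hbd, map_zero])
      refine ⟨w + w', Submodule.add_mem _ hw hw', ?_⟩
      rw [map_add, hbw, hbw', lmap_id]
      abel
  obtain ⟨j, hj⟩ := exists_pow_lt_of_lt_one (show (0 : ℝ) < δ / 2 by linarith)
    (show 1 - s < 1 by linarith)
  obtain ⟨h1, w, hw, hbw⟩ := hiter j
  have hpow : 0 ≤ (1 - s) ^ j := pow_nonneg (by linarith) j
  have h2 : lmap (shrink c s)^[j] z ∈
      chains {l | l ∈ listsIn C ∧ ∀ p ∈ l, ∀ v, |p v - c v| ≤ (1 - s) ^ j} n := by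
    refine lmap_mem_chains (B := A) (fun l hl => ?_) hz'
    refine ⟨?_, fun p hp v => ?_⟩
    · intro x hx
      obtain ⟨p, hp, rfl⟩ := List.mem_map.1 hx
      have hC : Set.MapsTo (shrink c s) C C := fun p hp => hconv p hp s hs0.le hs1
      exact hC.iterate j (hl.1 p hp)
    · obtain ⟨p', hp', rfl⟩ := List.mem_map.1 hp
      exact shrink_iterate_sub_le hs1 (hbdd p' (hl.1 p' hp')) j v
  have hcone : ∀ l ∈ {l | l ∈ listsIn C ∧ ∀ p ∈ l, ∀ v, |p v - c v| ≤ (1 - s) ^ j},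
      c :: l ∈ smallLists C δ := by
    refine fun l hl => ⟨fun x hx => ?_, 2 * (1 - s) ^ j, by linarith, fun p hp q hq v => ?_⟩
    · rcases List.mem_cons.1 hx with rfl | hx
      exacts [hc, hl.1 x hx]
    have hcl : ∀ p ∈ c :: l, |p v - c v| ≤ (1 - s) ^ j := fun p hp => by
      rcases List.mem_cons.1 hp with rfl | hp
      · simpa using hpow
      · exact hl.2 p hp v
    calc |p v - q v| ≤ |p v - c v| + |c v - q v| := abs_sub_le _ _ _
      _ ≤ (1 - s) ^ j + (1 - s) ^ j := add_le_add (hcl p hp) (by rw [abs_sub_comm]; exact hcl q hq)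
      _ = 2 * (1 - s) ^ j := by ring
  -- The chain `w` joins `z` to its shrunken image, and the cone fills that image.
  refine ⟨w + cone c (lmap (shrink c s)^[j] z), Submodule.add_mem _ hw
    (cone_mem_chains hcone h2), ?_⟩
  rw [map_add, hbw, bd_cone, bd_lmap, hbd]
  simp

/-! ### Points of the geometric realization -/

/-- The convex combinations of the vertices in `U`, in barycentric coordinates. -/
def hull (U : Set V) : Set (V → ℝ) :=
  {t | (∀ v, 0 ≤ t v) ∧ ∃ s : Finset V, ↑s ⊆ U ∧ (∀ v ∉ s, t v = 0) ∧ ∑ v ∈ s, t v = 1}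

theorem hull_mono {U U' : Set V} (h : U ⊆ U') : hull U ⊆ hull U' :=
  fun _ ⟨h0, s, hs, h1⟩ => ⟨h0, s, hs.trans h, h1⟩

theorem hull_finset {s : Finset V} {t : V → ℝ} (ht : t ∈ hull (s : Set V)) :
    (∀ v ∉ s, t v = 0) ∧ ∑ v ∈ s, t v = 1 := by
  obtain ⟨-, s', hs', h0, h1⟩ := ht
  refine ⟨fun v hv => h0 v fun h => hv (hs' h), ?_⟩
  rw [← h1]
  exact (Finset.sum_subset (Finset.coe_subset.1 hs') fun v _ hv => h0 v hv).symm

theorem hull_le_one {U : Set V} {t : V → ℝ} (ht : t ∈ hull U) (v : V) : t v ≤ 1 := by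
  obtain ⟨h, s, -, h0, h1⟩ := ht
  by_cases hv : v ∈ s
  · rw [← h1]
    exact Finset.single_le_sum (fun v _ => h v) hv
  · rw [h0 v hv]
    exact zero_le_one

theorem mem_of_hull_ne_zero {U : Set V} {t : V → ℝ} (ht : t ∈ hull U) {v : V} (hv : t v ≠ 0) :
    v ∈ U := by
  obtain ⟨-, s, hs, h0, -⟩ := ht
  by_contra h
  exact hv (h0 v fun h' => h (hs h'))

theorem single_mem_hull [DecidableEq V] {U : Set V} {v : V} (hv : v ∈ U) :
    (Pi.single v 1 : V → ℝ) ∈ hull U := by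
  refine ⟨fun w => ?_, {v}, by simpa using hv, fun w hw => ?_, by simp⟩
  · by_cases h : w = v
    · subst h
      simp
    · simp [h]
  · simp [Finset.mem_singleton.not.1 hw]

theorem shrink_mem_hull {U : Set V} {c p : V → ℝ} (hc : c ∈ hull U) (hp : p ∈ hull U) {s : ℝ}
    (h0 : 0 ≤ s) (h1 : s ≤ 1) : shrink c s p ∈ hull U := by
  classical
  obtain ⟨hc0, a, ha, hca, hc1⟩ := hc
  obtain ⟨hp0, b, hb, hpb, hp1⟩ := hp
  refine ⟨fun v => add_nonneg (mul_nonneg (by linarith) (hp0 v)) (mul_nonneg h0 (hc0 v)), a ∪ b,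
    by simp [ha, hb], fun v hv => ?_, ?_⟩
  · rw [Finset.mem_union, not_or] at hv
    simp [shrink, hca v hv.1, hpb v hv.2]
  · have e1 : ∑ v ∈ a ∪ b, c v = 1 := by
      rw [← hc1]
      exact (Finset.sum_subset Finset.subset_union_left fun v _ hv => hca v hv).symm
    have e2 : ∑ v ∈ a ∪ b, p v = 1 := by
      rw [← hp1]
      exact (Finset.sum_subset Finset.subset_union_right fun v _ hv => hpb v hv).symm
    simp only [shrink, Finset.sum_add_distrib, ← Finset.mul_sum, e1, e2]
    ring

theorem acyclic_smallLists_hull {U : Set V} {v : V} (hv : v ∈ U) {δ : ℝ} (hδ : 0 < δ) :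
    Acyclic (smallLists (hull U) δ) := by
  classical
  refine acyclic_smallLists (single_mem_hull hv)
    (fun p hp s h0 h1 => shrink_mem_hull (single_mem_hull hv) hp h0 h1) (fun p hp w => ?_) hδ
  have h1 := hull_le_one hp w
  have h2 := hp.1 w
  have h3 := hull_le_one (single_mem_hull hv) w
  have h4 := (single_mem_hull hv).1 w
  rw [abs_le]
  constructor <;> linarith

variable (X : AbstractSimplicialComplex V)

theorem continuous_coord (v : V) : Continuous fun t : Realization X => t.1 v := by
  refine continuous_iSup_dom.2 fun s => continuous_coinduced_dom.2 ?_
  by_cases hv : v ∈ s.1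
  · have : (fun t : Realization X => t.1 v) ∘ simplexMap X s = fun t => t.1 ⟨v, hv⟩ := by
      funext t
      exact Subtype.val_injective.extend_apply t.1 0 ⟨v, hv⟩
    rw [this]
    exact (continuous_apply _).comp continuous_subtype_val
  · have : (fun t : Realization X => t.1 v) ∘ simplexMap X s = fun t => 0 := by
      funext t
      exact Function.extend_apply' (f := Subtype.val) t.1 0 v (by rintro ⟨a, rfl⟩; exact hv a.2)
    rw [this]
    exact continuous_const

theorem continuous_simplexMap (s : X.faces) : Continuous (simplexMap X s) :=
  continuous_iSup_rng continuous_coinduced_rng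

variable {X}

theorem exists_support (t : Realization X) : ∃ s ∈ X.faces, ∀ v, v ∈ s ↔ 0 < t.1 v := by
  classical
  obtain ⟨h, s, hs, h0, h1⟩ := t.2
  refine ⟨s.filter fun v => 0 < t.1 v, (X.isRelLowerSet_faces hs).2 (Finset.filter_subset _ _) ?_,
    fun v => ?_⟩
  · by_contra hne
    rw [Finset.not_nonempty_iff_eq_empty, Finset.filter_eq_empty_iff] at hne
    have : ∑ v ∈ s, t.1 v ≤ 0 := Finset.sum_nonpos fun v hv => not_lt.1 (hne hv)
    linarith
  · rw [Finset.mem_filter, and_iff_right_iff_imp]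
    intro hv
    by_contra hvs
    exact hv.ne' (h0 v hvs)

/-- A compact set of the realization meets only finitely many open simplices. -/
theorem finite_supports (hfin : IsLocallyFinite X) {K : Set (Realization X)} (hK : IsCompact K) :
    {s : Finset V | s ∈ X.faces ∧ ∃ t ∈ K, ∀ v, v ∈ s ↔ 0 < t.1 v}.Finite := by
  -- The open stars of the vertices cover `K`. Finitely many suffice, and local finiteness leaves
  -- finitely many simplices at each of their vertices.
  obtain ⟨b, hb⟩ := hK.elim_finite_subcover (fun v : V => {t : Realization X | 0 < t.1 v})
    (fun v => isOpen_lt continuous_const (continuous_coord X v)) (fun t _ => by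
      obtain ⟨s, hs, hst⟩ := exists_support t
      obtain ⟨v, hv⟩ := (X.isRelLowerSet_faces hs).1
      exact Set.mem_iUnion.2 ⟨v, (hst v).1 hv⟩)
  refine (b.finite_toSet.biUnion fun v _ => hfin v).subset ?_
  rintro s ⟨hs, t, ht, hst⟩
  obtain ⟨v, hv, htv⟩ := Set.mem_iUnion₂.1 (hb ht)
  exact Set.mem_iUnion₂.2 ⟨v, hv, hs, (hst v).2 htv⟩

theorem exists_simplexMap_eq {s : Finset V} (hs : s ∈ X.faces) {p : V → ℝ}
    (hp : p ∈ hull (s : Set V)) :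
    ∃ x : stdSimplex ℝ {v // v ∈ s}, (simplexMap X ⟨s, hs⟩ x).1 = p ∧ ∀ a, x.1 a = p a.1 := by
  obtain ⟨h0, h1⟩ := hull_finset hp
  refine ⟨⟨fun a => p a.1, fun a => hp.1 a, ?_⟩, ?_, fun a => rfl⟩
  · rw [← h1]
    exact Finset.sum_coe_sort s p
  · funext v
    by_cases hv : v ∈ s
    · exact Subtype.val_injective.extend_apply _ _ (⟨v, hv⟩ : {v // v ∈ s})
    · rw [h0 v hv]
      exact Function.extend_apply' _ _ _ (by rintro ⟨a, rfl⟩; exact hv a.2)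

/-- A homotopy is uniformly continuous on every closed simplex, for the supremum distance. -/
theorem exists_modulus (hfin : IsLocallyFinite X)
    (H : C(unitInterval × Realization X, Realization X)) {s : Finset V} (hs : s ∈ X.faces) {ε : ℝ}
    (hε : 0 < ε) : ∃ δ > 0, ∀ t t' : unitInterval, ∀ x y : Realization X,
      x.1 ∈ hull (s : Set V) → y.1 ∈ hull (s : Set V) → dist t t' < δ →
      (∀ v, |x.1 v - y.1 v| < δ) → ∀ v, |(H (t, x)).1 v - (H (t', y)).1 v| < ε := by
  let g : unitInterval × stdSimplex ℝ {v // v ∈ s} → Realization X :=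
    fun q => H (q.1, simplexMap X ⟨s, hs⟩ q.2)
  have hg : Continuous g := H.continuous.comp
    (continuous_fst.prodMk ((continuous_simplexMap X ⟨s, hs⟩).comp continuous_snd))
  -- The image of the compact prism meets finitely many open simplices. Only the coordinates at
  -- their finitely many vertices `W` can be nonzero on it, so uniform continuity into a finite
  -- product is enough.
  have hW := Set.Finite.biUnion (finite_supports hfin (isCompact_range hg))
    (t := fun s : Finset V => (s : Set V)) fun s _ => s.finite_toSet
  set W := ⋃ s ∈ {s : Finset V | s ∈ X.faces ∧ ∃ t ∈ Set.range g, ∀ v, v ∈ s ↔ 0 < t.1 v},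
    (s : Set V) with hWdef
  have : Fintype W := hW.fintype
  have hcont : Continuous fun q => fun w : W => (g q).1 w.1 :=
    continuous_pi fun w => (continuous_coord X w.1).comp hg
  obtain ⟨δ, hδ, hd⟩ := Metric.uniformContinuous_iff.1
    (CompactSpace.uniformContinuous_of_continuous hcont) ε hε
  refine ⟨δ, hδ, fun t t' x y hx hy htt hxy v => ?_⟩
  obtain ⟨x', hx', hxx⟩ := exists_simplexMap_eq hs hx
  obtain ⟨y', hy', hyy⟩ := exists_simplexMap_eq hs hy
  obtain rfl : simplexMap X ⟨s, hs⟩ x' = x := Subtype.ext hx'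
  obtain rfl : simplexMap X ⟨s, hs⟩ y' = y := Subtype.ext hy'
  have hzero : ∀ q, v ∉ W → (g q).1 v = 0 := fun q hv => by
    obtain ⟨s', hs', hst⟩ := exists_support (g q)
    by_contra hne
    refine hv (Set.mem_iUnion₂.2 ⟨s', ⟨hs', g q, ⟨q, rfl⟩, hst⟩, ?_⟩)
    exact (hst v).2 (lt_of_le_of_ne ((g q).2.1 v) (Ne.symm hne))
  by_cases hv : v ∈ W
  · have h1 : dist (t, x') (t', y') < δ := by
      rw [Prod.dist_eq]
      refine max_lt htt ?_
      rw [Subtype.dist_eq, dist_pi_lt_iff hδ]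
      intro a
      rw [hxx, hyy, Real.dist_eq]
      exact hxy a
    have h2 := (dist_pi_lt_iff hε).1 (hd h1) ⟨v, hv⟩
    rwa [Real.dist_eq] at h2
  · have h1 : (H (t, simplexMap X ⟨s, hs⟩ x')).1 v = 0 := hzero (t, x') hv
    have h2 : (H (t', simplexMap X ⟨s, hs⟩ y')).1 v = 0 := hzero (t', y') hv
    rw [h1, h2]
    simpa using hε

end

noncomputable section

open Filter Topology

variable {V : Type*} {X : AbstractSimplicialComplex V}

/-! ### Acyclicity of a contractible complex -/

/-- The lists of vertices which lie in a common simplex. -/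
def faceLists (X : AbstractSimplicialComplex V) : Set (List V) :=
  {l | ∃ s ∈ X.faces, l ∈ listsIn (s : Set V)}

theorem faceClosed_faceLists : FaceClosed (faceLists X) := fun _ ⟨s, hs, hl⟩ _ hm =>
  ⟨s, hs, faceClosed_listsIn _ _ hl _ hm⟩

/-- A vertex with barycentric coordinate at least `1 / N`. -/
theorem exists_large_coord {N : ℕ} (hN : ∀ s ∈ X.faces, s.card ≤ N) (t : Realization X) :
    ∃ v, (N : ℝ)⁻¹ ≤ t.1 v := by
  obtain ⟨h, s, hs, h0, h1⟩ := t.2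
  have hne := (X.isRelLowerSet_faces hs).1
  have hc : (0 : ℝ) < s.card := by exact_mod_cast hne.card_pos
  obtain ⟨v, -, hv⟩ := Finset.exists_le_of_sum_le (s := s) (f := fun _ => (s.card : ℝ)⁻¹)
    (g := t.1) hne (by rw [h1, Finset.sum_const, nsmul_eq_mul, mul_inv_cancel₀ hc.ne'])
  refine ⟨v, le_trans ?_ hv⟩
  exact inv_anti₀ hc (by exact_mod_cast hN s hs)

theorem isPoint_of_mem_hull {s : Finset V} (hs : s ∈ X.faces) {p : V → ℝ}
    (hp : p ∈ hull (s : Set V)) :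
    (∀ v, 0 ≤ p v) ∧ ∃ s ∈ X.faces, (∀ v, v ∉ s → p v = 0) ∧ ∑ v ∈ s, p v = 1 :=
  ⟨hp.1, s, hs, hull_finset hp⟩

/-- Homologous images of a cycle under a sequence of successively contiguous vertex maps. -/
theorem exists_bd_eq_of_contiguous {P : Type*} {A : Set (List P)} (hA : FaceClosed A)
    {B : Set (List V)} (ρ : ℕ → P → V)
    (h : ∀ j, ∀ l ∈ A, listsIn {x | x ∈ l.map (ρ j) ++ l.map (ρ (j + 1))} ⊆ B)
    {n : ℕ} {z : Ch P} (hz : z ∈ chains A n) (hbd : bd z = 0) (j : ℕ) :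
    ∃ w ∈ chains B (n + 1), bd w = lmap (ρ 0) z - lmap (ρ j) z := by
  induction j with
  | zero => exact ⟨0, Submodule.zero_mem _, by simp⟩
  | succ j ih =>
    obtain ⟨w, hw, hbw⟩ := ih
    obtain ⟨w', hw', hbw'⟩ := exists_bd_eq_lmap_sub_lmap hA B (ρ j) (ρ (j + 1)) (h j) hz hbd
    exact ⟨w + w', Submodule.add_mem _ hw hw', by rw [map_add, hbw, hbw']; abel⟩

/-- Let `r` send a point of `|X|` to a vertex with coordinate at least `1 / N`. If a family of
points differs from a point `q` by less than `1 / N` in every coordinate, then `r` sends all of them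
into the support of `q`, hence into one simplex. A cycle `z` is replaced by a fine cycle `S z` of
points of `|X|`, adapted to the modulus of continuity of the contraction `H`. The maps `r ∘ H_t` at
closely spaced times are then contiguous on `S z`, so the images of `S z` at times `0` and `1` are
homologous. The image at time `1` lies over a single vertex and bounds; the image at time `0` is
homologous to `z`, because `r ∘ S` is carried by the vertices of each list. -/
theorem acyclic_faceLists (hfin : IsLocallyFinite X) [hcontr : ContractibleSpace (Realization X)]
    {N : ℕ} (hN : ∀ s ∈ X.faces, s.card ≤ N) : Acyclic (faceLists X) := by
  classical
  intro n z hz hbd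
  obtain ⟨y₀, ⟨H⟩⟩ := id_nullhomotopic (Realization X)
  choose r hr using exists_large_coord (X := X) hN
  obtain ⟨s₀, hs₀, -⟩ := exists_support y₀
  have hN0 : 0 < (N : ℝ)⁻¹ := by
    have h1 := (X.isRelLowerSet_faces hs₀).1.card_pos
    have h2 := hN s₀ hs₀
    exact inv_pos.2 (by exact_mod_cast h1.trans_le h2)
  -- a common modulus of continuity on the simplices of the cycle
  let Mod : Finset V → ℝ → Prop := fun s δ =>
    ∀ t t' : unitInterval, ∀ x y : Realization X,
      x.1 ∈ hull (s : Set V) → y.1 ∈ hull (s : Set V) → dist t t' < δ →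
      (∀ v, |x.1 v - y.1 v| < δ) → ∀ v, |(H (t, x)).1 v - (H (t', y)).1 v| < (N : ℝ)⁻¹
  have hδ : ∃ δ > 0, ∀ l ∈ z.support, ∃ s ∈ X.faces, l ∈ listsIn (s : Set V) ∧ Mod s δ := by
    have : ∀ᶠ δ in 𝓝[>] (0 : ℝ), ∀ l ∈ z.support,
        ∃ s ∈ X.faces, l ∈ listsIn (s : Set V) ∧ Mod s δ := by
      rw [eventually_all_finset]
      intro l hl
      obtain ⟨s, hs, hls⟩ := (hz hl).1
      obtain ⟨δ, hδ, hmod⟩ := exists_modulus hfin H.toContinuousMap hs hN0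
      filter_upwards [Ioo_mem_nhdsGT hδ] with η hη
      exact ⟨s, hs, hls, fun t t' x y hx hy htt hxy =>
        hmod t t' x y hx hy (htt.trans hη.2) fun v => (hxy v).trans hη.2⟩
    obtain ⟨δ, h1, h2⟩ := (this.and self_mem_nhdsWithin).exists
    exact ⟨δ, h2, h1⟩
  obtain ⟨δ, hδ, hzδ⟩ := hδ
  let A : Set (List V) := {l | ∃ s ∈ X.faces, l ∈ listsIn (s : Set V) ∧ Mod s δ}
  have hA : FaceClosed A := fun l ⟨s, hs, hl, hmod⟩ m hm =>
    ⟨s, hs, faceClosed_listsIn _ _ hl _ hm, hmod⟩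
  have hzA : z ∈ chains A n := fun l hl => ⟨hzδ l hl, (hz hl).2⟩
  -- subdivision
  obtain ⟨S, hS0, hS⟩ := exists_chainMap_of_acyclic hA
    (fun l => smallLists (hull {v | v ∈ l}) δ)
    (fun l _ m hm => smallLists_mono (hull_mono fun v hv => hm.subset hv) δ)
    ⟨by simp [listsIn], 0, hδ, by simp⟩
    (fun l _ hl => by
      obtain ⟨a, l, rfl⟩ := List.exists_cons_of_ne_nil hl
      exact acyclic_smallLists_hull (v := a) (by simp) hδ)
  let B : Set (List (V → ℝ)) := {l | ∃ s ∈ X.faces, l ∈ smallLists (hull (s : Set V)) δ ∧ Mod s δ}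
  have hB : FaceClosed B := fun l ⟨s, hs, hl, hmod⟩ m hm =>
    ⟨s, hs, ⟨faceClosed_listsIn _ _ hl.1 _ hm, by
      obtain ⟨η, hη, h⟩ := hl.2
      exact ⟨η, hη, fun p hp q hq => h p (hm.subset hp) q (hm.subset hq)⟩⟩, hmod⟩
  have hSB : S z ∈ chains B n := by
    refine map_mem_of_mem_chains _ _ (fun l hl hn => ?_) hzA
    rw [← hn]
    refine chains_mono (fun m hm => ?_) _ (hS l hl).1
    obtain ⟨s, hs, hls, hmod⟩ := hl
    exact ⟨s, hs, smallLists_mono (hull_mono fun v hv => hls v hv) δ hm, hmod⟩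
  have hSbd : bd (S z) = 0 := by
    have := eqOn_chains (f := bd ∘ₗ S) (g := S ∘ₗ bd) (fun l hl _ => (hS l hl).2) hzA
    simpa [hbd] using this
  -- the vertex maps given by the contraction
  obtain ⟨M, hM⟩ := exists_nat_gt δ⁻¹
  have hM0 : (0 : ℝ) < M := (inv_pos.2 hδ).trans hM
  let τ : ℕ → unitInterval := fun j => Set.projIcc 0 1 zero_le_one ((j : ℝ) / M)
  have hτ : ∀ j, dist (τ j) (τ (j + 1)) < δ := fun j => by
    refine ((LipschitzWith.projIcc zero_le_one).dist_le_mul _ _).trans_lt ?_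
    rw [NNReal.coe_one, one_mul, Real.dist_eq, ← sub_div, abs_div, abs_of_pos hM0]
    push_cast
    rw [sub_add_cancel_left, abs_neg, abs_one, one_div]
    exact inv_lt_of_inv_lt₀ hδ hM
  -- The value off the realization is arbitrary; the lists in `B` consist of points of `|X|`.
  let ρ : ℕ → (V → ℝ) → V := fun j p =>
    if h : (∀ v, 0 ≤ p v) ∧ ∃ s ∈ X.faces, (∀ v, v ∉ s → p v = 0) ∧ ∑ v ∈ s, p v = 1 then
      r (H (τ j, ⟨p, h⟩)) else r y₀
  have hρ : ∀ j (t : Realization X), ρ j t.1 = r (H (τ j, t)) := fun j t => dif_pos t.2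
  have hcontig : ∀ j, ∀ l ∈ B,
      listsIn {x | x ∈ l.map (ρ j) ++ l.map (ρ (j + 1))} ⊆ faceLists X := by
    rintro j l ⟨s, hs, ⟨hl, η, hη, hsm⟩, hmod⟩ m hm
    rcases l with _ | ⟨p₀, l⟩
    · exact ⟨s, hs, fun x hx => by simpa using hm x hx⟩
    let t₀ : Realization X := ⟨p₀, isPoint_of_mem_hull hs (hl p₀ (by simp))⟩
    obtain ⟨s', hs', hst⟩ := exists_support (H (τ j, t₀))
    -- The vertex chosen for `H (τ k, t)` has coordinate at least `1 / N` there, and this changes by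
    -- less than `1 / N` on passing to `H (τ j, t₀)`. It is therefore positive at the latter point,
    -- whose support is `s'`.
    have key : ∀ k, dist (τ j) (τ k) < δ → ∀ p ∈ p₀ :: l, ρ k p ∈ s' := by
      intro k hk p hp
      let t : Realization X := ⟨p, isPoint_of_mem_hull hs (hl p hp)⟩
      rw [show p = t.1 from rfl, hρ, hst]
      have h1 := hmod (τ j) (τ k) t₀ t (hl p₀ (by simp)) (hl p hp) hk
        (fun v => (hsm p₀ (by simp) p hp v).trans_lt hη) (r (H (τ k, t)))
      have h2 := hr (H (τ k, t))
      have := (abs_lt.1 h1).1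
      linarith
    refine ⟨s', hs', fun x hx => ?_⟩
    rcases List.mem_append.1 (hm x hx) with h | h
    · obtain ⟨p, hp, rfl⟩ := List.mem_map.1 h
      exact key j (by simpa using hδ) p hp
    · obtain ⟨p, hp, rfl⟩ := List.mem_map.1 h
      exact key (j + 1) (hτ j) p hp
  obtain ⟨w₁, hw₁, hbw₁⟩ := exists_bd_eq_of_contiguous hB ρ hcontig hSB hSbd M
  -- the end of the contraction is constant
  obtain ⟨w₂, hw₂, hbw₂⟩ : ∃ w ∈ chains (faceLists X) (n + 1), bd w = lmap (ρ M) (S z) := by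
    obtain ⟨w, hw, hbw⟩ := acyclic_listsIn (U := {r y₀}) rfl n (lmap (ρ M) (S z))
      (lmap_mem_chains (B := B) (C := listsIn {r y₀}) (fun l ⟨s, hs, hl, _⟩ x hx => by
        obtain ⟨p, hp, rfl⟩ := List.mem_map.1 hx
        let t : Realization X := ⟨p, isPoint_of_mem_hull hs (hl.1 p hp)⟩
        rw [show p = t.1 from rfl, hρ]
        have : τ M = 1 := by
          simp only [τ, div_self hM0.ne']
          exact Set.projIcc_right _
        rw [this, H.apply_one]
        rfl) hSB)
      (by rw [bd_lmap, hSbd, map_zero])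
    have hsub : listsIn {r y₀} ⊆ faceLists X := fun l hl =>
      ⟨{r y₀}, X.singleton_mem _, by simpa using hl⟩
    exact ⟨w, chains_mono hsub _ hw, hbw⟩
  -- the beginning is carried by the simplices
  obtain ⟨h, hh⟩ := exists_chainHomotopy_of_acyclic hA (fun l => listsIn {v | v ∈ l})
    (fun l _ m hm => listsIn_mono fun v hv => hm.subset hv)
    (fun l _ hl => by
      obtain ⟨a, l, rfl⟩ := List.exists_cons_of_ne_nil hl
      exact acyclic_listsIn (a := a) (by simp))
    LinearMap.id (lmap (ρ 0) ∘ₗ S) (by simp [hS0])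
    (fun l _ => gen_mem_chains (fun v hv => hv) rfl)
    (fun l ⟨s, hs, hls, _⟩ => by
      refine lmap_mem_chains (fun m hm x hx => ?_) (hS l ⟨s, hs, hls, ‹_›⟩).1
      obtain ⟨p, hp, rfl⟩ := List.mem_map.1 hx
      have hpl := hm.1 p hp
      let t : Realization X :=
        ⟨p, isPoint_of_mem_hull hs (hull_mono (fun v hv => hls v hv) hpl)⟩
      rw [show p = t.1 from rfl, hρ]
      have : τ 0 = 0 := by
        simp only [τ, Nat.cast_zero, zero_div]
        exact Set.projIcc_left _
      rw [this, H.apply_zero]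
      exact mem_of_hull_ne_zero hpl (hN0.trans_le (hr t)).ne')
    (fun l _ => rfl)
    (fun l hl => by
      rw [LinearMap.comp_apply, bd_lmap, (hS l hl).2]
      rfl)
  have hhz : bd (h z) = z - lmap (ρ 0) (S z) := by
    have := eqOn_chains (f := bd ∘ₗ h + h ∘ₗ bd) (g := LinearMap.id - lmap (ρ 0) ∘ₗ S)
      (fun l hl _ => (hh l hl).2) hzA
    simpa [hbd] using this
  -- The three boundaries telescope: `z - ρ₀(S z)`, then `ρ₀(S z) - ρ_M(S z)`, then `ρ_M(S z)`.
  refine ⟨h z + w₁ + w₂, Submodule.add_mem _ (Submodule.add_mem _ ?_ hw₁) hw₂, ?_⟩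
  · refine map_mem_of_mem_chains _ _ (fun l hl hn => ?_) hzA
    rw [← hn]
    refine chains_mono (fun m hm => ?_) _ (hh l hl).1
    obtain ⟨s, hs, hls, -⟩ := hl
    exact ⟨s, hs, fun x hx => hls x (hm x hx)⟩
  · rw [map_add, map_add, hhz, hbw₁, hbw₂]
    abel

end

noncomputable section

/-! ### Lists of values of tuples -/

section Tuples

variable {P : Type*} {M : Type*} [AddCommGroup M] [Module ℝ M]

theorem swapAt_swapAt (i : ℕ) (l : List P) : swapAt i (swapAt i l) = l := by
  induction i generalizing l with
  | zero => rcases l with _ | ⟨a, _ | ⟨b, l⟩⟩ <;> simp [swapAt]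
  | succ i ih => rcases l with _ | ⟨a, l⟩ <;> simp [swapAt, ih]

theorem swapAt_ofFn {n : ℕ} (x : Fin (n + 1) → P) (i : Fin n) :
    swapAt i (List.ofFn x) = List.ofFn (x ∘ Equiv.swap i.castSucc i.succ) := by
  induction n with
  | zero => exact i.elim0
  | succ n ih =>
    rw [List.ofFn_succ, List.ofFn_succ (f := x ∘ _)]
    induction i using Fin.cases with
    | zero =>
      rw [List.ofFn_succ, List.ofFn_succ (f := fun j => (x ∘ _) _)]
      simp only [Fin.val_zero, swapAt_zero, Function.comp_apply, Fin.castSucc_zero,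
        Equiv.swap_apply_left, Equiv.swap_apply_right]
      congr 3
    | succ i =>
      rw [Fin.val_succ, swapAt_succ, ih]
      congr 2
      funext j
      simp only [Function.comp_apply]
      congr 1
      exact (Fin.succ_injective (n + 1)).map_swap i.castSucc i.succ j

theorem bd_ofFn {n : ℕ} (x : Fin (n + 1) → P) :
    bd (gen (List.ofFn x)) =
      ∑ i : Fin (n + 1), (-1 : ℝ) ^ (i : ℕ) • gen (List.ofFn fun j => x (i.succAbove j)) := by
  induction n with
  | zero => simp
  | succ n ih =>
    rw [List.ofFn_succ, bd_cons, ih, Fin.sum_univ_succ (n := n + 1), map_sum, sub_eq_add_neg,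
      ← Finset.sum_neg_distrib]
    congr 1
    · simp
    · refine Finset.sum_congr rfl fun i _ => ?_
      rw [map_smul, cone_gen, List.ofFn_succ]
      simp [pow_succ]

/-- Adjacent transpositions generate the symmetric group. -/
theorem IsAlt.perm {F : Ch P →ₗ[ℝ] M} (hF : IsAlt F) {n : ℕ} (x : Fin (n + 1) → P)
    (p : Equiv.Perm (Fin (n + 1))) :
    F (gen (List.ofFn (x ∘ p))) = ((Equiv.Perm.sign p : ℤ) : ℝ) • F (gen (List.ofFn x)) := by
  have hp : p ∈ Submonoid.closure
      (Set.range fun i : Fin n => Equiv.swap i.castSucc i.succ) := by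
    rw [Equiv.Perm.mclosure_swap_castSucc_succ]
    trivial
  induction hp using Submonoid.closure_induction generalizing x with
  | mem p hp =>
    obtain ⟨i, rfl⟩ := hp
    have h := hF (List.ofFn x) i (by simp)
    rw [swapAt_ofFn] at h
    rw [Equiv.Perm.sign_swap (Fin.castSucc_lt_succ).ne]
    simpa [eq_neg_iff_add_eq_zero, add_comm] using h
  | one => simp
  | mul p q _ _ hp hq =>
    have := hq (x ∘ p)
    rw [hp, smul_smul] at this
    rw [Equiv.Perm.sign_mul]
    push_cast
    rw [mul_comm]
    exact this

theorem exists_ofFn_eq {n : ℕ} {l : List P} (hl : l.length = n) :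
    ∃ x : Fin n → P, List.ofFn x = l := by
  subst hl
  exact ⟨_, List.ofFn_get l⟩

/-- Exchanging two equal entries fixes the tuple but changes the sign, and `2` is invertible. -/
theorem IsAlt.eq_zero_of_not_injective {F : Ch P →ₗ[ℝ] M} (hF : IsAlt F) {n : ℕ}
    {x : Fin (n + 1) → P} (hx : ¬ Function.Injective x) : F (gen (List.ofFn x)) = 0 := by
  simp only [Function.Injective, not_forall] at hx
  obtain ⟨i, j, hij, hne⟩ := hx
  have h := hF.perm x (Equiv.swap i j)
  have e : x ∘ Equiv.swap i j = x := by
    funext k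
    rw [Function.comp_apply, Equiv.swap_apply_def]
    split_ifs with h1 h2
    · rw [h1, hij]
    · rw [h2, hij]
    · rfl
  rw [e, Equiv.Perm.sign_swap hne] at h
  have h2 : (2 : ℝ) • F (gen (List.ofFn x)) = 0 := by
    rw [two_smul]
    nth_rewrite 1 [h]
    simp
  exact (smul_eq_zero.1 h2).resolve_left two_ne_zero

end Tuples

/-! ### Operators between Orlicz sequence spaces -/

namespace YoungFunction

variable {φ ψ : YoungFunction} {S T : Type*}

theorem modular_scale (c : ℝ) (hc : 0 < c) (f : S → ℝ) :
    (φ.scale c hc).modular f = ENNReal.ofReal c * φ.modular f := by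
  rw [modular, modular, ← ENNReal.tsum_mul_left]
  refine tsum_congr fun x => ?_
  rw [← ENNReal.ofReal_mul hc.le]
  rfl

namespace Ell

/-- A linear map which increases modulars at most by a constant factor is continuous for the
Luxemburg norms. -/
def ofModularLE (A : (S → ℝ) →ₗ[ℝ] (T → ℝ)) (C : ℝ) (hC : 1 ≤ C)
    (hA : ∀ f, ψ.modular (A f) ≤ ENNReal.ofReal C * φ.modular f) : φ.Ell S →L[ℝ] ψ.Ell T :=
  LinearMap.mkContinuous
    { toFun := fun f => ⟨A f.1, by
        obtain ⟨α, hα, hf⟩ := f.2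
        refine ⟨α, hα, ?_⟩
        rw [← map_smul]
        exact (hA _).trans_lt (ENNReal.mul_lt_top ENNReal.ofReal_lt_top hf)⟩
      map_add' := fun f g => Subtype.ext (map_add A f.1 g.1)
      map_smul' := fun c f => Subtype.ext (map_smul A c f.1) } C (fun f => by
    have hC0 : 0 < C := one_pos.trans_le hC
    -- For `a > C ‖f‖`, write `f = b y` with `y` of modular at most `1` and `b C < a`. By convexity
    -- `C⁻¹ • A y` has modular at most `C⁻¹ * C = 1`, so `b C` bounds the norm of `A f`.
    refine le_of_forall_gt_imp_ge_of_dense fun a ha => ?_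
    have ha' : ‖f‖ < a / C := by
      rw [lt_div_iff₀ hC0, mul_comm]
      exact ha
    rw [norm_eq_gauge] at ha'
    obtain ⟨b, hb0, hb, y, hy, hyf⟩ := exists_lt_of_gauge_lt absorbent_ball ha'
    have hba : b * C ≤ a := ((lt_div_iff₀ hC0).1 hb).le
    rw [norm_eq_gauge]
    refine le_trans (gauge_le_of_mem (mul_pos hb0 hC0).le ?_) hba
    rw [Set.mem_smul_set_iff_inv_smul_mem₀ (mul_pos hb0 hC0).ne']
    have hy' : φ.modular y.1 ≤ 1 := hy
    change ψ.modular ((b * C)⁻¹ • A f.1) ≤ 1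
    have e : (b * C)⁻¹ • A f.1 = C⁻¹ • A y.1 := by
      have : f.1 = b • y.1 := by
        rw [← hyf]
        rfl
      rw [this, map_smul, smul_smul, mul_inv, mul_right_comm, inv_mul_cancel₀ hb0.ne', one_mul]
    rw [e]
    have hC1 : |C⁻¹| ≤ 1 := by
      rw [abs_of_pos (inv_pos.2 hC0)]
      exact inv_le_one_of_one_le₀ hC
    calc ψ.modular (C⁻¹ • A y.1) ≤ ENNReal.ofReal |C⁻¹| * ψ.modular (A y.1) :=
          ψ.modular_smul_le _ hC1
      _ ≤ ENNReal.ofReal |C⁻¹| * (ENNReal.ofReal C * 1) := by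
          gcongr
          exact (hA _).trans (by gcongr)
      _ = 1 := by
          rw [mul_one, abs_of_pos (inv_pos.2 hC0), ← ENNReal.ofReal_mul (inv_pos.2 hC0).le,
            inv_mul_cancel₀ hC0.ne', ENNReal.ofReal_one])

/-- The restriction along an injective map. -/
def restrict {c : ℝ} {hc : 0 < c} {j : S → T} (hj : Function.Injective j) :
    (φ.scale c hc).Ell T →L[ℝ] φ.Ell S :=
  ofModularLE (LinearMap.funLeft ℝ ℝ j) (max 1 c⁻¹) (le_max_left _ _) fun f => by
    calc φ.modular (f ∘ j) ≤ φ.modular f :=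
          ENNReal.tsum_comp_le_tsum_of_injective hj fun x => ENNReal.ofReal (φ (f x))
      _ = ENNReal.ofReal c⁻¹ * (φ.scale c hc).modular f := by
          rw [modular_scale, ← mul_assoc, ← ENNReal.ofReal_mul (inv_pos.2 hc).le,
            inv_mul_cancel₀ hc.ne', ENNReal.ofReal_one, one_mul]
      _ ≤ _ := by
          gcongr
          exact le_max_right _ _

/-- The extension by zero along an injective map. -/
def extend {c : ℝ} {hc : 0 < c} {j : S → T} (hj : Function.Injective j) :
    φ.Ell S →L[ℝ] (φ.scale c hc).Ell T :=
  ofModularLE (Function.ExtendByZero.linearMap ℝ j) (max 1 c) (le_max_left _ _) fun f => by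
    have e : φ.modular (Function.ExtendByZero.linearMap ℝ j f) = φ.modular f := by
      have : (fun y => ENNReal.ofReal (φ (Function.ExtendByZero.linearMap ℝ j f y))) =
          Function.extend j (fun x => ENNReal.ofReal (φ (f x))) 0 := by
        funext y
        change ENNReal.ofReal (φ (Function.extend j f 0 y)) = _
        by_cases hy : ∃ x, j x = y
        · obtain ⟨x, rfl⟩ := hy
          rw [hj.extend_apply, hj.extend_apply]
        · rw [Function.extend_apply' _ _ _ hy, Function.extend_apply' _ _ _ hy]
          simp [φ.map_zero]
      rw [modular, this, tsum_extend_zero hj]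
      rfl
    rw [modular_scale, e]
    gcongr
    exact le_max_right _ _

theorem extend_apply {c : ℝ} {hc : 0 < c} {j : S → T} (hj : Function.Injective j)
    (f : φ.Ell S) (x : S) : extend (hc := hc) hj f (j x) = f x :=
  hj.extend_apply f.1 0 x

theorem extend_apply_of_notMem {c : ℝ} {hc : 0 < c} {j : S → T} (hj : Function.Injective j)
    (f : φ.Ell S) (y : T) (hy : ¬ ∃ x, j x = y) : extend (hc := hc) hj f y = 0 :=
  Function.extend_apply' (f := j) f.1 0 y hy

end Ell

end YoungFunction

/-! ### Homotopy equivalences and cohomology -/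

section Cohomology

/-- Continuous linear maps which are inverse to each other modulo subspaces induce an isomorphism of
the quotients. -/
theorem nonempty_quotient_equiv {M N : Type*} [AddCommGroup M] [Module ℝ M] [TopologicalSpace M]
    [AddCommGroup N] [Module ℝ N] [TopologicalSpace N] {p : Submodule ℝ M} {q : Submodule ℝ N}
    (f : M →L[ℝ] N) (g : N →L[ℝ] M) (hf : ∀ x ∈ p, f x ∈ q) (hg : ∀ y ∈ q, g y ∈ p)
    (hgf : ∀ x, x - g (f x) ∈ p) (hfg : ∀ y, y - f (g y) ∈ q) :
    Nonempty ((M ⧸ p) ≃L[ℝ] (N ⧸ q)) := by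
  refine ⟨{ toLinearEquiv := LinearEquiv.ofLinearMap (p.mapQ q f.toLinearMap hf)
              (q.mapQ p g.toLinearMap hg) ?_ ?_
            continuous_toFun := ?_
            continuous_invFun := ?_ }⟩
  · refine LinearMap.ext fun y => ?_
    obtain ⟨y, rfl⟩ := q.mkQ_surjective y
    exact ((Submodule.Quotient.eq q).2 (hfg y)).symm
  · refine LinearMap.ext fun x => ?_
    obtain ⟨x, rfl⟩ := p.mkQ_surjective x
    exact ((Submodule.Quotient.eq p).2 (hgf x)).symm
  · exact (f.continuous.quotient_map' (s := p.quotientRel) (t := q.quotientRel) fun x y h => by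
      rw [Submodule.quotientRel_def] at h ⊢
      rw [← map_sub]
      exact hf _ h)
  · exact (g.continuous.quotient_map' (s := q.quotientRel) (t := p.quotientRel) fun x y h => by
      rw [Submodule.quotientRel_def] at h ⊢
      rw [← map_sub]
      exact hg _ h)

variable {A B : ℕ → Type*}
  [∀ k, AddCommGroup (A k)] [∀ k, Module ℝ (A k)] [∀ k, TopologicalSpace (A k)]
  [∀ k, AddCommGroup (B k)] [∀ k, Module ℝ (B k)] [∀ k, TopologicalSpace (B k)]
  {dA : ∀ k, A k →L[ℝ] A (k + 1)} {dB : ∀ k, B k →L[ℝ] B (k + 1)}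

theorem coboundaries_map {f : ∀ k, A k →L[ℝ] B k}
    (hf : ∀ k x, f (k + 1) (dA k x) = dB k (f k x)) (k : ℕ) :
    ∀ x ∈ coboundaries dA k, f k x ∈ coboundaries dB k := by
  rcases k with _ | k
  · intro x hx
    obtain rfl : x = 0 := hx
    rw [map_zero]
    exact Submodule.zero_mem _
  · rintro _ ⟨x, rfl⟩
    exact ⟨f k x, (hf k x).symm⟩

/-- Ordinary and reduced cohomology are treated together: `p` and `q` stand for the coboundaries or
their closures. The hypotheses `hpq` and `hqp` ask only that continuous maps preserving coboundaries
preserve these subspaces. On cocycles the homotopy formula leaves a coboundary, which lies in either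
choice. -/
theorem nonempty_equiv_of_homotopyEquivalent (h : HomotopyEquivalent dA dB) (k : ℕ)
    (p : Submodule ℝ (A k)) (q : Submodule ℝ (B k))
    (hp : coboundaries dA k ≤ p) (hq : coboundaries dB k ≤ q)
    (hpq : ∀ f : A k →L[ℝ] B k, (∀ x ∈ coboundaries dA k, f x ∈ coboundaries dB k) →
      ∀ x ∈ p, f x ∈ q)
    (hqp : ∀ f : B k →L[ℝ] A k, (∀ x ∈ coboundaries dB k, f x ∈ coboundaries dA k) →
      ∀ x ∈ q, f x ∈ p) :
    Nonempty ((↥(dA k).ker ⧸ p.comap (dA k).ker.subtype) ≃L[ℝ]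
      (↥(dB k).ker ⧸ q.comap (dB k).ker.subtype)) := by
  obtain ⟨f, g, s, t, hf, hg, hs0, hs, ht0, ht⟩ := h
  refine nonempty_quotient_equiv
    (((f k).comp (dA k).ker.subtypeL).codRestrict (dB k).ker fun x => ?_)
    (((g k).comp (dB k).ker.subtypeL).codRestrict (dA k).ker fun x => ?_)
    (fun x hx => hpq (f k) (coboundaries_map hf k) x.1 hx)
    (fun x hx => hqp (g k) (coboundaries_map hg k) x.1 hx) (fun x => hp ?_) (fun y => hq ?_)
  · have : dA k x.1 = 0 := x.2
    change dB k (f k x.1) = 0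
    rw [← hf, this, map_zero]
  · have : dB k x.1 = 0 := x.2
    change dA k (g k x.1) = 0
    rw [← hg, this, map_zero]
  · have hx : dA k x.1 = 0 := x.2
    change x.1 - g k (f k x.1) ∈ _
    rcases k with _ | k
    · rw [hs0, hx, map_zero]
      exact Submodule.zero_mem _
    · rw [hs, hx, map_zero, add_zero]
      exact ⟨_, rfl⟩
  · have hy : dB k y.1 = 0 := y.2
    change y.1 - f k (g k y.1) ∈ _
    rcases k with _ | k
    · rw [ht0, hy, map_zero]
      exact Submodule.zero_mem _
    · rw [ht, hy, map_zero, add_zero]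
      exact ⟨_, rfl⟩

theorem HomotopyEquivalent.nonempty_cohomology_equiv (h : HomotopyEquivalent dA dB) (k : ℕ) :
    Nonempty (Cohomology dA k ≃L[ℝ] Cohomology dB k) :=
  nonempty_equiv_of_homotopyEquivalent h k _ _ le_rfl le_rfl (fun _ h => h) (fun _ h => h)

theorem HomotopyEquivalent.nonempty_reducedCohomology_equiv
    [∀ k, IsTopologicalAddGroup (A k)] [∀ k, ContinuousSMul ℝ (A k)]
    [∀ k, IsTopologicalAddGroup (B k)] [∀ k, ContinuousSMul ℝ (B k)]
    (h : HomotopyEquivalent dA dB) (k : ℕ) :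
    Nonempty (ReducedCohomology dA k ≃L[ℝ] ReducedCohomology dB k) :=
  nonempty_equiv_of_homotopyEquivalent h k _ _ (Submodule.le_topologicalClosure _)
    (Submodule.le_topologicalClosure _)
    (fun f hf _ hx => map_mem_closure f.continuous hx hf)
    (fun f hf _ hx => map_mem_closure f.continuous hx hf)

end Cohomology

end

noncomputable section

/-! ### Evaluation of group cochains on chains -/

section GroupEvaluation

variable {φ : YoungFunction} {G : Type*} [Group G] [TopologicalSpace G] {k : ℕ}

open Classical in
/-- The value of an invariant cochain on a list, which is zero unless the list has length `k + 1`. -/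
def evalGroupList (φ : YoungFunction) (k : ℕ) (l : List G) :
    InvariantCochain φ G k →L[ℝ] φ.Ell G :=
  if h : ∃ x : Fin (k + 1) → G, List.ofFn x = l then
    (ContinuousMap.evalCLM ℝ h.choose).comp (InvariantCochain φ G k).subtypeL
  else 0

/-- The value of an invariant cochain on a chain. -/
def evalGroup (φ : YoungFunction) (G : Type*) [Group G] [TopologicalSpace G] (k : ℕ) :
    Ch G →ₗ[ℝ] (InvariantCochain φ G k →L[ℝ] φ.Ell G) :=
  extendLin (evalGroupList φ k)

theorem evalGroup_ofFn (x : Fin (k + 1) → G) (ω : InvariantCochain φ G k) :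
    evalGroup φ G k (gen (List.ofFn x)) ω = ω.1 x := by
  have h : ∃ y : Fin (k + 1) → G, List.ofFn y = List.ofFn x := ⟨x, rfl⟩
  rw [evalGroup, extendLin_gen, evalGroupList, dif_pos h]
  change ω.1 h.choose = ω.1 x
  rw [List.ofFn_injective h.choose_spec]

/-- This is the invariance of `ω` read on chains: evaluation is equivariant into the right regular
representation, as `evalSimplex_lmap` shows for `X`. -/
theorem evalGroup_lmap (g : G) {c : Ch G} (hc : c ∈ chains Set.univ (k + 1))
    (ω : InvariantCochain φ G k) (y : G) :
    evalGroup φ G k (lmap (g • ·) c) ω y = evalGroup φ G k c ω (y * g) := by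
  have := eqOn_chains (f := LinearMap.applyₗ ω ∘ₗ (ContinuousLinearMap.coeLM ℝ) ∘ₗ
      evalGroup φ G k ∘ₗ lmap (g • ·))
    (g := rightRegular φ G g ∘ₗ LinearMap.applyₗ ω ∘ₗ (ContinuousLinearMap.coeLM ℝ) ∘ₗ
      evalGroup φ G k) (fun l _ hl => by
      obtain ⟨x, rfl⟩ := exists_ofFn_eq hl
      change evalGroup φ G k (lmap (g • ·) (gen _)) ω =
        rightRegular φ G g (evalGroup φ G k (gen _) ω)
      rw [lmap_gen, List.map_ofFn, evalGroup_ofFn, evalGroup_ofFn]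
      have := ω.2 g ((g • ·) ∘ x)
      rw [← this]
      simp) hc
  exact congrArg (fun u : φ.Ell G => u y) this

/-- The coboundary is the transpose of `bd`, so identities between chain maps become identities
between cochain maps. -/
theorem evalGroup_coboundary {c : Ch G} (hc : c ∈ chains Set.univ (k + 2))
    (ω : InvariantCochain φ G k) :
    evalGroup φ G (k + 1) c (groupCoboundary φ G k ω) = evalGroup φ G k (bd c) ω := by
  refine eqOn_chains (f := LinearMap.applyₗ (groupCoboundary φ G k ω) ∘ₗ
      (ContinuousLinearMap.coeLM ℝ) ∘ₗ evalGroup φ G (k + 1))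
    (g := LinearMap.applyₗ ω ∘ₗ (ContinuousLinearMap.coeLM ℝ) ∘ₗ evalGroup φ G k ∘ₗ bd)
    (fun l _ hl => ?_) hc
  obtain ⟨x, rfl⟩ := exists_ofFn_eq hl
  change evalGroup φ G (k + 1) (gen _) (groupCoboundary φ G k ω) =
    evalGroup φ G k (bd (gen _)) ω
  rw [evalGroup_ofFn, bd_ofFn]
  simp only [map_sum, map_smul, sum_apply, smul_apply, evalGroup_ofFn]
  simp only [groupCoboundary, ContinuousLinearMap.coe_codRestrict_apply,
    ContinuousLinearMap.comp_apply, Submodule.subtypeL_apply, sum_apply, smul_apply,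
    ContinuousMap.sum_apply, ContinuousMap.smul_apply]
  rfl

theorem InvariantCochain.ext_evalGroup {ω η : InvariantCochain φ G k}
    (h : ∀ c ∈ chains Set.univ (k + 1), evalGroup φ G k c ω = evalGroup φ G k c η) : ω = η := by
  refine Subtype.ext (ContinuousMap.ext fun x => ?_)
  rw [← evalGroup_ofFn, ← evalGroup_ofFn]
  exact h _ (gen_mem_chains trivial (by simp))

/-- An equivariant family of continuous linear maps with values in `ℓ^φ(G)` defines a continuous
linear map with values in the invariant cochains. -/
theorem exists_toInvariantCochain [DiscreteTopology G] {Z : Type*} [AddCommGroup Z] [Module ℝ Z]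
    [TopologicalSpace Z] (K : Ch G →ₗ[ℝ] (Z →L[ℝ] φ.Ell G))
    (hK : ∀ (g : G) (l : List G), l.length = k + 1 → ∀ z y,
      K (gen (l.map (g • ·))) z y = K (gen l) z (y * g)) :
    ∃ D : Z →L[ℝ] InvariantCochain φ G k,
      ∀ c ∈ chains Set.univ (k + 1), ∀ z, evalGroup φ G k c (D z) = K c z := by
  let F : Z →L[ℝ] C(Fin (k + 1) → G, φ.Ell G) :=
    { toFun := fun z => ⟨fun x => K (gen (List.ofFn x)) z, continuous_of_discreteTopology⟩
      map_add' := fun z w => ContinuousMap.ext fun x => map_add (K (gen (List.ofFn x))) z w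
      map_smul' := fun r z => ContinuousMap.ext fun x => map_smul (K (gen (List.ofFn x))) r z
      cont := by
        -- Since `G` is discrete, the compact-open topology is the product topology and continuity
        -- is tested at each tuple.
        refine (ContinuousMap.isHomeomorph_coe (X := Fin (k + 1) → G)
          (Y := φ.Ell G)).isInducing.continuous_iff.2 ?_
        exact continuous_pi fun x => (K (gen (List.ofFn x))).continuous }
  refine ⟨F.codRestrict (InvariantCochain φ G k) fun z g x => ?_, fun c hc z => ?_⟩
  · ext y
    change K (gen (List.ofFn fun i => g⁻¹ * x i)) z (y * g) = K (gen (List.ofFn x)) z y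
    rw [← hK g _ (by simp)]
    simp [Function.comp_def]
  · refine eqOn_chains (f := LinearMap.applyₗ (F.codRestrict (InvariantCochain φ G k) _ z) ∘ₗ
        (ContinuousLinearMap.coeLM ℝ) ∘ₗ evalGroup φ G k)
      (g := LinearMap.applyₗ z ∘ₗ (ContinuousLinearMap.coeLM ℝ) ∘ₗ K) (fun l _ hl => ?_) hc
    obtain ⟨x, rfl⟩ := exists_ofFn_eq hl
    exact evalGroup_ofFn x _

end GroupEvaluation

/-! ### Group actions on simplicial complexes -/

section SimplicialAction

/-- This bounds the dimension of `X`, as the choice of vertices with large coordinates in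
`acyclic_faceLists` requires. -/
theorem card_le_of_vertices {G V : Type*} [Group G] [MulAction G V]
    {X : AbstractSimplicialComplex V} {W : Finset V}
    (hW : ∀ s ∈ X.faces, ∃ g : G, ∀ v ∈ s, g⁻¹ • v ∈ W) :
    ∀ s ∈ X.faces, s.card ≤ W.card := fun s hs => by
  obtain ⟨g, hg⟩ := hW s hs
  exact Finset.card_le_card_of_injOn (g⁻¹ • ·) hg (MulAction.injective g⁻¹).injOn

variable {G V : Type*} [Group G] [MulAction G V] {X : AbstractSimplicialComplex V}
  [SimplicialAction G X] {k : ℕ}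

instance : MulAction G (OrderedSimplex X k) where
  smul g σ :=
    { vertex := fun j => g • σ.vertex j
      injective := (MulAction.injective g).comp σ.injective
      mem := by
        have := SimplicialAction.map_mem (X := X) g _ σ.mem
        rwa [Finset.map_map] at this }
  one_smul σ := OrderedSimplex.ext (funext fun j => one_smul G (σ.vertex j))
  mul_smul g h σ := OrderedSimplex.ext (funext fun j => mul_smul g h (σ.vertex j))

/-- The list of vertices of an ordered simplex. -/
def OrderedSimplex.list (σ : OrderedSimplex X k) : List V := List.ofFn σ.vertex

@[simp] theorem OrderedSimplex.length_list (σ : OrderedSimplex X k) : σ.list.length = k + 1 := by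
  simp [OrderedSimplex.list]

theorem OrderedSimplex.list_injective :
    Function.Injective (OrderedSimplex.list : OrderedSimplex X k → List V) :=
  fun _ _ h => OrderedSimplex.ext (List.ofFn_injective h)

theorem OrderedSimplex.list_smul (g : G) (σ : OrderedSimplex X k) :
    (g • σ).list = σ.list.map (g • ·) := by
  rw [OrderedSimplex.list, OrderedSimplex.list, List.map_ofFn]
  rfl

theorem OrderedSimplex.list_mem (σ : OrderedSimplex X k) : σ.list ∈ faceLists X :=
  ⟨_, σ.mem, fun v hv => by
    obtain ⟨j, rfl⟩ := List.mem_ofFn.1 hv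
    exact Finset.mem_coe.2 (Finset.mem_map.2 ⟨j, Finset.mem_univ _, rfl⟩)⟩

theorem OrderedSimplex.gen_list_mem (σ : OrderedSimplex X k) :
    gen σ.list ∈ chains (faceLists X) (k + 1) :=
  gen_mem_chains σ.list_mem (by simp)

/-- A tuple of distinct vertices of a simplex is an ordered simplex. -/
theorem exists_orderedSimplex {x : Fin (k + 1) → V} (hx : Function.Injective x)
    (h : List.ofFn x ∈ faceLists X) : ∃ σ : OrderedSimplex X k, σ.list = List.ofFn x := by
  obtain ⟨s, hs, hxs⟩ := h
  refine ⟨⟨x, hx, (X.isRelLowerSet_faces hs).2 (fun v hv => ?_) Finset.univ_nonempty.map⟩, rfl⟩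
  obtain ⟨j, -, rfl⟩ := Finset.mem_map.1 hv
  exact hxs _ (List.mem_ofFn.2 ⟨j, rfl⟩)

theorem map_smul_mem_faceLists (g : G) {l : List V} (hl : l ∈ faceLists X) :
    l.map (g • ·) ∈ faceLists X := by
  obtain ⟨s, hs, hls⟩ := hl
  refine ⟨_, SimplicialAction.map_mem g s hs, fun x hx => ?_⟩
  obtain ⟨v, hv, rfl⟩ := List.mem_map.1 hx
  exact Finset.mem_coe.2 (Finset.mem_map.2 ⟨v, hls v hv, rfl⟩)

theorem smul_realization_apply (g : G) (t : Realization X) (v : V) :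
    (g • t).1 v = t.1 (g⁻¹ • v) := rfl

/-- A free action on the realization is free on the vertices. -/
theorem free_on_vertices (hfree : ∀ (g : G) (x : Realization X), g • x = x → g = 1) (g : G) (v : V)
    (h : g • v = v) : g = 1 := by
  classical
  have hv := isPoint_of_mem_hull (X.singleton_mem v)
    (single_mem_hull (U := (({v} : Finset V) : Set V)) (v := v) (by simp))
  refine hfree g ⟨_, hv⟩ (Subtype.ext (funext fun w => ?_))
  change (Pi.single v 1 : V → ℝ) (g⁻¹ • w) = (Pi.single v 1 : V → ℝ) w
  simp only [Pi.single_apply, inv_smul_eq_iff, h]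

/-- For a cocompact action, finitely many vertices carry representatives of all simplices. -/
theorem exists_finite_vertices (hfin : IsLocallyFinite X)
    (hcocompact : ∃ K : Set (Realization X), IsCompact K ∧ ∀ x, ∃ g : G, ∃ y ∈ K, g • y = x) :
    ∃ W : Finset V, ∀ s ∈ X.faces, ∃ g : G, ∀ v ∈ s, g⁻¹ • v ∈ W := by
  classical
  obtain ⟨K, hK, hKG⟩ := hcocompact
  refine ⟨(finite_supports hfin hK).toFinset.biUnion id, fun s hs => ?_⟩
  have hne := (X.isRelLowerSet_faces hs).1
  have hc : (0 : ℝ) < s.card := by exact_mod_cast hne.card_pos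
  -- The barycentre of `s` has all of `s` as support, so translating it into `K` carries every
  -- vertex of `s` into the support of one point of `K`.
  let b : Realization X := ⟨fun v => if v ∈ s then (s.card : ℝ)⁻¹ else 0, fun v => by
    positivity, s, hs, fun v hv => if_neg hv, by
    rw [Finset.sum_ite_mem, Finset.inter_self, Finset.sum_const, nsmul_eq_mul,
      mul_inv_cancel₀ hc.ne']⟩
  obtain ⟨g, y, hy, hgy⟩ := hKG b
  obtain ⟨s', hs', hst⟩ := exists_support y
  refine ⟨g, fun v hv => Finset.mem_biUnion.2 ⟨s', ?_, (hst _).2 ?_⟩⟩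
  · exact (Set.Finite.mem_toFinset _).2 ⟨hs', y, hy, hst⟩
  · rw [← smul_realization_apply, hgy]
    change 0 < if v ∈ s then (s.card : ℝ)⁻¹ else 0
    rw [if_pos hv]
    exact inv_pos.2 hc

theorem finite_orbits {W : Finset V} (hW : ∀ s ∈ X.faces, ∃ g : G, ∀ v ∈ s, g⁻¹ • v ∈ W) (k : ℕ) :
    Finite (MulAction.orbitRel.Quotient G (OrderedSimplex X k)) := by
  have h1 : Finite {σ : OrderedSimplex X k // ∀ j, σ.vertex j ∈ W} := by
    refine Finite.of_injective (β := Fin (k + 1) → W) (fun σ j => ⟨σ.1.vertex j, σ.2 j⟩) ?_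
    intro σ τ h
    refine Subtype.ext (OrderedSimplex.ext (funext fun j => ?_))
    exact congrArg Subtype.val (congrFun h j)
  refine Finite.of_surjective
    (fun σ : {σ : OrderedSimplex X k // ∀ j, σ.vertex j ∈ W} =>
      (Quotient.mk (MulAction.orbitRel G (OrderedSimplex X k)) σ.1)) fun q => ?_
  obtain ⟨σ, rfl⟩ := Quotient.exists_rep q
  obtain ⟨g, hg⟩ := hW _ σ.mem
  refine ⟨⟨g⁻¹ • σ, fun j => hg _ (Finset.mem_map.2 ⟨j, Finset.mem_univ _, rfl⟩)⟩, ?_⟩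
  exact Quotient.sound (MulAction.orbitRel_apply.2 ⟨g⁻¹, rfl⟩)

theorem OrderedSimplex.smul_left_injective (hfree : ∀ (g : G) (v : V), g • v = v → g = 1)
    (σ : OrderedSimplex X k) : Function.Injective fun g : G => g • σ := by
  intro g h hgh
  have h1 : g • σ.vertex 0 = h • σ.vertex 0 :=
    congrArg (fun τ : OrderedSimplex X k => τ.vertex 0) hgh
  have h2 := hfree (h⁻¹ * g) (σ.vertex 0) (by rw [mul_smul, h1, inv_smul_smul])
  rw [inv_mul_eq_one] at h2
  exact h2.symm

end SimplicialAction

/-! ### Evaluation of simplicial cochains on chains -/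

section SimplicialEvaluation

variable {φ : YoungFunction} {G V : Type*} [Group G] [MulAction G V]
  {X : AbstractSimplicialComplex V} [SimplicialAction G X] {k : ℕ}

open Classical in
/-- The values of a simplicial cochain on the translates of a list of vertices, which are zero
unless the list is a `k`-simplex. -/
def evalSimplexList (φ : YoungFunction) (k : ℕ) (hfree : ∀ (g : G) (v : V), g • v = v → g = 1)
    (l : List V) : SimplicialCochain X φ k →L[ℝ] φ.Ell G :=
  if h : ∃ σ : OrderedSimplex X k, σ.list = l then
    (YoungFunction.Ell.restrict (OrderedSimplex.smul_left_injective hfree h.choose)).comp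
      (SimplicialCochain X φ k).subtypeL
  else 0

/-- The values of a simplicial cochain on the translates of a chain. -/
def evalSimplex (X : AbstractSimplicialComplex V) [SimplicialAction G X] (φ : YoungFunction)
    (k : ℕ) (hfree : ∀ (g : G) (v : V), g • v = v → g = 1) :
    Ch V →ₗ[ℝ] (SimplicialCochain X φ k →L[ℝ] φ.Ell G) :=
  extendLin (evalSimplexList φ k hfree)

variable {hfree : ∀ (g : G) (v : V), g • v = v → g = 1}

theorem evalSimplex_list (σ : OrderedSimplex X k) (θ : SimplicialCochain X φ k) (y : G) :
    evalSimplex X φ k hfree (gen σ.list) θ y = θ.1 (y • σ) := by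
  have h : ∃ τ : OrderedSimplex X k, τ.list = σ.list := ⟨σ, rfl⟩
  rw [evalSimplex, extendLin_gen, evalSimplexList, dif_pos h]
  change θ.1 (y • h.choose) = θ.1 (y • σ)
  rw [OrderedSimplex.list_injective h.choose_spec]

theorem evalSimplex_eq_zero {l : List V} (hl : ¬ ∃ σ : OrderedSimplex X k, σ.list = l) :
    evalSimplex X φ k hfree (gen l) = 0 := by
  rw [evalSimplex, extendLin_gen, evalSimplexList, dif_neg hl]

theorem evalSimplex_lmap (g : G) (c : Ch V) (θ : SimplicialCochain X φ k) (y : G) :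
    evalSimplex X φ k hfree (lmap (g • ·) c) θ y = evalSimplex X φ k hfree c θ (y * g) := by
  have : LinearMap.applyₗ θ ∘ₗ (ContinuousLinearMap.coeLM ℝ) ∘ₗ evalSimplex X φ k hfree ∘ₗ
      lmap (g • ·) = rightRegular φ G g ∘ₗ LinearMap.applyₗ θ ∘ₗ (ContinuousLinearMap.coeLM ℝ) ∘ₗ
      evalSimplex X φ k hfree := by
    refine Ch.hom_ext fun l => YoungFunction.Ell.ext fun y => ?_
    change evalSimplex X φ k hfree (lmap (g • ·) (gen l)) θ y =
      evalSimplex X φ k hfree (gen l) θ (y * g)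
    rw [lmap_gen]
    by_cases h : ∃ σ : OrderedSimplex X k, σ.list = l
    · obtain ⟨σ, rfl⟩ := h
      rw [← OrderedSimplex.list_smul, evalSimplex_list, evalSimplex_list, mul_smul]
    · have h' : ¬ ∃ σ : OrderedSimplex X k, σ.list = l.map (g • ·) := by
        rintro ⟨σ, hσ⟩
        refine h ⟨g⁻¹ • σ, ?_⟩
        rw [OrderedSimplex.list_smul, hσ, List.map_map]
        simp [Function.comp_def]
      rw [evalSimplex_eq_zero h, evalSimplex_eq_zero h']
      rfl
  exact congrArg (fun u : φ.Ell G => u y) (LinearMap.congr_fun this c)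

theorem swapAt_list (σ : OrderedSimplex X k) (i : Fin k) :
    swapAt i σ.list = (σ.perm (Equiv.swap i.castSucc i.succ)).list :=
  swapAt_ofFn _ _

/-- On simplices this is the sign rule for cochains. A list that is not a `k`-simplex remains one
that is not after the exchange, and both values are zero. -/
theorem isAlt_evalSimplex : IsAlt (evalSimplex X φ k hfree) := by
  intro l i hi
  by_cases h : ∃ σ : OrderedSimplex X k, σ.list = l
  · obtain ⟨σ, rfl⟩ := h
    obtain ⟨i, rfl⟩ : ∃ j : Fin k, j.1 = i := ⟨⟨i, by simpa using hi⟩, rfl⟩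
    refine ContinuousLinearMap.ext fun θ => YoungFunction.Ell.ext fun y => ?_
    change evalSimplex X φ k hfree (gen σ.list) θ y +
      evalSimplex X φ k hfree (gen (swapAt i σ.list)) θ y = 0
    rw [swapAt_list, evalSimplex_list, evalSimplex_list]
    have := θ.2 (y • σ) (Equiv.swap i.castSucc i.succ)
    rw [Equiv.Perm.sign_swap (Fin.castSucc_lt_succ).ne] at this
    change _ + θ.1 ((y • σ).perm (Equiv.swap i.castSucc i.succ)) = 0
    rw [this]
    simp
  · have h' : ¬ ∃ σ : OrderedSimplex X k, σ.list = swapAt i l := by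
      rintro ⟨σ, hσ⟩
      have hl : l = swapAt i σ.list := by rw [hσ, swapAt_swapAt]
      have hi' : i < k := by
        rw [hl, length_swapAt] at hi
        simpa using hi
      exact h ⟨_, (swapAt_list σ ⟨i, hi'⟩).symm.trans hl.symm⟩
    rw [evalSimplex_eq_zero h, evalSimplex_eq_zero h', add_zero]

/-- The component at `y = 1` of the evaluation on the list of `σ` is `θ σ`. -/
theorem SimplicialCochain.ext_evalSimplex (hfree : ∀ (g : G) (v : V), g • v = v → g = 1)
    {θ η : SimplicialCochain X φ k}
    (h : ∀ c ∈ chains (faceLists X) (k + 1),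
      evalSimplex X φ k hfree c θ = evalSimplex X φ k hfree c η) : θ = η := by
  refine Subtype.ext (YoungFunction.Ell.ext fun σ => ?_)
  have := congrArg (fun u : φ.Ell G => u 1) (h _ σ.gen_list_mem)
  simp only [evalSimplex_list, one_smul] at this
  exact this

/-- Two alternating maps which agree on the ordered simplices agree on the chains of lists of
vertices of simplices. -/
theorem IsAlt.eq_of_simplices {M : Type*} [AddCommGroup M] [Module ℝ M] {F F' : Ch V →ₗ[ℝ] M}
    (hF : IsAlt F) (hF' : IsAlt F')
    (h : ∀ σ : OrderedSimplex X k, F (gen σ.list) = F' (gen σ.list)) {c : Ch V}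
    (hc : c ∈ chains (faceLists X) (k + 1)) : F c = F' c := by
  refine eqOn_chains (fun l hl hn => ?_) hc
  obtain ⟨x, rfl⟩ := exists_ofFn_eq hn
  by_cases hx : Function.Injective x
  · obtain ⟨σ, hσ⟩ := exists_orderedSimplex hx hl
    rw [← hσ, h]
  · rw [hF.eq_zero_of_not_injective hx, hF'.eq_zero_of_not_injective hx]

/-- An equivariant alternating family of continuous linear maps with values in `ℓ^φ(G)` defines a
continuous linear map with values in the simplicial cochains. -/
theorem exists_toSimplicialCochain (hfree : ∀ (g : G) (v : V), g • v = v → g = 1)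
    [Finite (MulAction.orbitRel.Quotient G (OrderedSimplex X k))]
    {Z : Type*} [AddCommGroup Z] [Module ℝ Z] [TopologicalSpace Z]
    (K : Ch V →ₗ[ℝ] (Z →L[ℝ] φ.Ell G)) (hKalt : IsAlt K)
    (hK : ∀ (g : G), ∀ l ∈ faceLists X, l.length = k + 1 → ∀ z y,
      K (gen (l.map (g • ·))) z y = K (gen l) z (y * g)) :
    ∃ D : Z →L[ℝ] SimplicialCochain X φ k,
      ∀ c ∈ chains (faceLists X) (k + 1), ∀ z, evalSimplex X φ k hfree c (D z) = K c z := by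
  classical
  have := Fintype.ofFinite (MulAction.orbitRel.Quotient G (OrderedSimplex X k))
  -- Each orbit is a copy of `G` by freeness. On it `F z` is the value of `K` on a representative,
  -- extended by zero off the orbit; the sum is finite, hence continuous.
  let F : Z →L[ℝ] (φ.scale ((k + 1).factorial : ℝ)⁻¹ (by positivity)).Ell (OrderedSimplex X k) :=
    ∑ q : MulAction.orbitRel.Quotient G (OrderedSimplex X k),
      (YoungFunction.Ell.extend (OrderedSimplex.smul_left_injective hfree q.out)).comp
        (K (gen q.out.list))
  have hF : ∀ z (σ : OrderedSimplex X k), F z σ = K (gen σ.list) z 1 := by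
    intro z σ
    have hpos : 0 < ((k + 1).factorial : ℝ)⁻¹ := by positivity
    let ev : (φ.scale ((k + 1).factorial : ℝ)⁻¹ (by positivity)).Ell (OrderedSimplex X k) →+ ℝ :=
      { toFun := fun f => f σ, map_zero' := rfl, map_add' := fun _ _ => rfl }
    have h1 : F z σ = ∑ q : MulAction.orbitRel.Quotient G (OrderedSimplex X k),
        YoungFunction.Ell.extend (hc := hpos)
          (OrderedSimplex.smul_left_injective hfree q.out) (K (gen q.out.list) z) σ := by
      change ev (F z) = _
      rw [show F z = _ from sum_apply _ _ _, map_sum]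
      rfl
    let q₀ : MulAction.orbitRel.Quotient G (OrderedSimplex X k) :=
      Quotient.mk (MulAction.orbitRel G (OrderedSimplex X k)) σ
    obtain ⟨g, hg⟩ : ∃ g : G, g • q₀.out = σ :=
      MulAction.orbitRel_apply.1
        (Setoid.symm' (MulAction.orbitRel G (OrderedSimplex X k)) (Quotient.exact (Quotient.out_eq q₀)))
    -- Orbits are disjoint, so only that of `σ` contributes; equivariance of `K` carries the value
    -- from the representative to `σ`.
    rw [h1, Finset.sum_eq_single q₀]
    · have h2 := YoungFunction.Ell.extend_apply (hc := hpos)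
        (OrderedSimplex.smul_left_injective hfree q₀.out) (K (gen q₀.out.list) z) g
      have h3 := hK g q₀.out.list q₀.out.list_mem (by simp) z 1
      rw [one_mul, ← OrderedSimplex.list_smul, hg] at h3
      rw [h3, ← h2]
      exact congrArg _ hg.symm
    · intro q _ hq
      refine YoungFunction.Ell.extend_apply_of_notMem _ _ _ ?_
      rintro ⟨g', hg'⟩
      refine hq ?_
      rw [← Quotient.out_eq q]
      exact Quotient.sound (Setoid.symm' (MulAction.orbitRel G (OrderedSimplex X k))
        (MulAction.orbitRel_apply.2 ⟨g', hg'⟩))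
    · simp
  refine ⟨F.codRestrict (SimplicialCochain X φ k) fun z σ p => ?_, fun c hc z => ?_⟩
  · rw [hF, hF]
    have : K (gen (σ.perm p).list) = _ := hKalt.perm σ.vertex p
    rw [this]
    rfl
  · refine IsAlt.eq_of_simplices (X := X) (k := k)
      (F := LinearMap.applyₗ (F.codRestrict (SimplicialCochain X φ k) _ z) ∘ₗ
        (ContinuousLinearMap.coeLM ℝ) ∘ₗ evalSimplex X φ k hfree)
      (F' := LinearMap.applyₗ z ∘ₗ (ContinuousLinearMap.coeLM ℝ) ∘ₗ K)
      ((isAlt_evalSimplex.map_comp _).map_comp _) ((hKalt.map_comp _).map_comp _)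
      (fun σ => YoungFunction.Ell.ext fun y => ?_) hc
    refine (evalSimplex_list σ _ y).trans ((hF z (y • σ)).trans ?_)
    rw [OrderedSimplex.list_smul, hK y _ σ.list_mem (by simp), one_mul]
    rfl

end SimplicialEvaluation

end

end OrliczCohomology

namespace OrliczCohomology

/-! ### The homotopy equivalence -/

section Main

variable {G V : Type*} [Group G] [MulAction G V] {X : AbstractSimplicialComplex V}
  [SimplicialAction G X]

/-- Equivariant chain maps between the chains of a free acyclic complex and those of the group,
with the alternation inserted, and equivariant homotopies. -/
theorem exists_equivariant_equivalence (hfree : ∀ (g : G) (v : V), g • v = v → g = 1)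
    (hX : Acyclic (faceLists X)) (hne : ∃ s, s ∈ X.faces) :
    ∃ (a : Ch V →ₗ[ℝ] Ch G) (b : Ch G →ₗ[ℝ] Ch V) (s : Ch V →ₗ[ℝ] Ch V) (t : Ch G →ₗ[ℝ] Ch G),
      (IsAlt a ∧ IsAlt s ∧ s (gen []) = 0 ∧ t (gen []) = 0) ∧
      (∀ n, ∀ c ∈ chains (faceLists X) n,
        a c ∈ chains Set.univ n ∧ s c ∈ chains (faceLists X) (n + 1) ∧ bd (a c) = a (bd c) ∧
        bd (s c) + s (bd c) = alt c - b (a c) ∧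
        ∀ g : G, a (lmap (g • ·) c) = lmap (g • ·) (a c) ∧
          s (lmap (g • ·) c) = lmap (g • ·) (s c)) ∧
      (∀ n, ∀ c ∈ chains Set.univ n,
        b c ∈ chains (faceLists X) n ∧ t c ∈ chains Set.univ (n + 1) ∧ bd (b c) = b (bd c) ∧
        bd (t c) + t (bd c) = c - a (b c) ∧
        ∀ g : G, b (lmap (g • ·) c) = lmap (g • ·) (b c) ∧
          t (lmap (g • ·) c) = lmap (g • ·) (t c)) := by
  have hGfree : ∀ g p : G, g • p = p → g = 1 := fun g p h => mul_eq_right.1 h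
  have hXG : ∀ (g : G), ∀ l ∈ faceLists X, l.map (g • ·) ∈ faceLists X :=
    fun g l hl => map_smul_mem_faceLists g hl
  have hnil : [] ∈ faceLists X := by
    obtain ⟨s, hs⟩ := hne
    exact ⟨s, hs, fun x hx => by simp at hx⟩
  have huniv : FaceClosed (Set.univ : Set (List G)) := fun _ _ _ _ => trivial
  have hGacyc : Acyclic (Set.univ : Set (List G)) := Acyclic.of_cons_mem 1 fun _ _ => trivial
  -- Freeness on vertices gives an equivariant map `v : V → G`. It already induces a chain map,
  -- since any tuple in `G` is a simplex.
  obtain ⟨v, -, hv⟩ := exists_equivariant_choice (Γ := G) (α := V) (β := G) Set.univ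
    (fun _ _ _ => trivial) (fun g x _ => hfree g x) (fun _ _ => True) (fun _ _ _ _ _ => trivial)
    (fun _ _ => ⟨1, trivial⟩)
  have halt : ∀ n, ∀ c ∈ chains (faceLists X) n, alt c ∈ chains (faceLists X) n := by
    refine fun n c hc => map_mem_of_mem_chains _ _ (fun l hl hn => ?_) hc
    obtain ⟨s, hs, hls⟩ := hl
    rw [← hn]
    have hsub : listsIn (s : Set V) ⊆ faceLists X := fun m hm => ⟨s, hs, hm⟩
    exact chains_mono hsub _ (alt_gen_mem hls)
  have hvG : ∀ (g : G) (c : Ch V), lmap v (lmap (g • ·) c) = lmap (g • ·) (lmap v c) :=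
    fun g c => by
      rw [lmap_lmap, lmap_lmap]
      congr 2
      funext x
      exact hv g x trivial
  -- In the other direction, the constant carrier with value the whole acyclic complex of `X`
  -- suffices.
  obtain ⟨b, hb0, hbG, hb⟩ := exists_chainMap (Γ := G) (P := G) (Q := V) hGfree huniv
    (fun _ _ _ => trivial) (fun _ => faceLists X) (fun _ _ _ _ => subset_rfl) hnil
    (fun g _ _ => hXG g) (fun _ _ _ => hX)
  have hbmem : ∀ n, ∀ c ∈ chains Set.univ n, b c ∈ chains (faceLists X) n :=
    fun n c hc => map_mem_of_mem_chains _ _ (fun l hl hn => hn ▸ (hb l hl).1) hc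
  have hbbd : ∀ n, ∀ c ∈ chains Set.univ n, bd (b c) = b (bd c) := fun n c hc =>
    eqOn_chains (f := bd ∘ₗ b) (g := b ∘ₗ bd) (fun l hl _ => (hb l hl).2) hc
  have hbG' : ∀ n, ∀ c ∈ chains Set.univ n, ∀ g : G,
      b (lmap (g • ·) c) = lmap (g • ·) (b c) := fun n c hc g =>
    eqOn_chains (f := b ∘ₗ lmap (g • ·)) (g := lmap (g • ·) ∘ₗ b)
      (fun l hl _ => by simpa using hbG g l hl) hc
  have hvmem : ∀ n, ∀ c ∈ chains (faceLists X) n, lmap v c ∈ chains Set.univ n :=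
    fun n c hc => lmap_mem_chains (C := Set.univ) (fun _ _ => trivial) hc
  obtain ⟨s, hs0, hsG, hs⟩ := exists_chainHomotopy (Γ := G) (P := V) (Q := V) hfree
    faceClosed_faceLists hXG (fun _ => faceLists X) (fun _ _ _ _ => subset_rfl) (fun g _ _ => hXG g)
    (fun _ _ _ => hX) LinearMap.id (b ∘ₗ lmap v) (by simp [hb0]) (fun g l _ => by simp)
    (fun g l hl => by
      rw [← lmap_gen, LinearMap.comp_apply, hvG,
        hbG' _ _ (hvmem _ _ (gen_mem_chains hl rfl))]
      rfl)
    (fun l hl => gen_mem_chains hl rfl)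
    (fun l hl => hbmem _ _ (hvmem _ _ (gen_mem_chains hl rfl)))
    (fun _ _ => rfl)
    (fun l hl => by
      rw [LinearMap.comp_apply, hbbd _ _ (hvmem _ _ (gen_mem_chains hl rfl)), bd_lmap]
      rfl)
  have hsbd : ∀ n, ∀ c ∈ chains (faceLists X) n, bd (s c) + s (bd c) = c - b (lmap v c) :=
    fun n c hc => eqOn_chains (f := bd ∘ₗ s + s ∘ₗ bd) (g := LinearMap.id - b ∘ₗ lmap v)
      (fun l hl _ => (hs l hl).2) hc
  have hsG' : ∀ n, ∀ c ∈ chains (faceLists X) n, ∀ g : G,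
      s (lmap (g • ·) c) = lmap (g • ·) (s c) := fun n c hc g =>
    eqOn_chains (f := s ∘ₗ lmap (g • ·)) (g := lmap (g • ·) ∘ₗ s)
      (fun l hl _ => by simpa using hsG g l hl) hc
  -- Alternation is inserted so that cochains pulled back along `a` are alternating.
  let a : Ch V →ₗ[ℝ] Ch G := lmap v ∘ₗ alt
  have habd : ∀ c, bd (a c) = a (bd c) := fun c => by
    simp only [a, LinearMap.comp_apply, bd_lmap, bd_alt]
  have haG : ∀ (g : G) c, a (lmap (g • ·) c) = lmap (g • ·) (a c) := fun g c => by
    simp only [a, LinearMap.comp_apply, alt_lmap, hvG]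
  have hgen : ∀ l : List G, gen l ∈ chains Set.univ l.length := fun l => gen_mem_chains trivial rfl
  obtain ⟨t, ht0, htG, ht⟩ := exists_chainHomotopy (Γ := G) (P := G) (Q := G) hGfree huniv
    (fun _ _ _ => trivial) (fun _ => Set.univ) (fun _ _ _ _ => subset_rfl)
    (fun _ _ _ _ _ => trivial) (fun _ _ _ => hGacyc) LinearMap.id (a ∘ₗ b)
    (by simp [a, hb0, alt_nil]) (fun g l _ => by simp)
    (fun g l _ => by
      rw [← lmap_gen, LinearMap.comp_apply, hbG' _ _ (hgen l), haG]
      rfl)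
    (fun l hl => gen_mem_chains hl rfl)
    (fun l hl => hvmem _ _ (halt _ _ (hbmem _ _ (hgen l))))
    (fun _ _ => rfl)
    (fun l hl => by
      rw [LinearMap.comp_apply, habd, hbbd _ _ (hgen l)]
      rfl)
  -- Since `alt` commutes with `bd`, composing `s` with it turns a homotopy from the identity to `b
  -- ∘ lmap v` into one from `alt` to `b ∘ a`.
  refine ⟨a, b, s ∘ₗ alt, t, ⟨isAlt_alt.map_comp _, isAlt_alt.map_comp _, by simp [alt_nil, hs0],
    ht0⟩, fun n c hc => ⟨hvmem _ _ (halt _ _ hc), ?_, habd c, ?_, fun g => ⟨haG g c, ?_⟩⟩,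
    fun n c hc => ⟨hbmem _ _ hc, ?_, hbbd _ _ hc, ?_, fun g => ⟨hbG' _ _ hc g, ?_⟩⟩⟩
  · exact map_mem_of_mem_chains s _ (fun l hl hn => hn ▸ (hs l hl).1) (halt _ _ hc)
  · have := hsbd _ _ (halt _ _ hc)
    rw [bd_alt] at this
    exact this
  · rw [LinearMap.comp_apply, alt_lmap, hsG' _ _ (halt _ _ hc)]
    rfl
  · exact map_mem_of_mem_chains _ _ (fun l hl hn => hn ▸ (ht l hl).1) hc
  · exact eqOn_chains (f := bd ∘ₗ t + t ∘ₗ bd) (g := LinearMap.id - a ∘ₗ b)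
      (fun l hl _ => (ht l hl).2) hc
  · exact eqOn_chains (f := t ∘ₗ lmap (g • ·)) (g := lmap (g • ·) ∘ₗ t)
      (fun l hl _ => by simpa using htG g l hl) hc

variable {φ : YoungFunction}

/-- The simplicial coboundary is a continuous linear map between spaces of `ℓ^φ`-cochains. -/
theorem exists_simplicialCoboundary (hfree : ∀ (g : G) (v : V), g • v = v → g = 1)
    (hfin : ∀ k, Finite (MulAction.orbitRel.Quotient G (OrderedSimplex X k))) (k : ℕ) :
    ∃ d : SimplicialCochain X φ k →L[ℝ] SimplicialCochain X φ (k + 1),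
      (∀ (θ : SimplicialCochain X φ k) (σ : OrderedSimplex X (k + 1)),
        (d θ).1 σ = ∑ i : Fin (k + 2), (-1 : ℝ) ^ (i : ℕ) * θ.1 (σ.face i)) ∧
      ∀ c ∈ chains (faceLists X) (k + 2), ∀ θ,
        evalSimplex X φ (k + 1) hfree c (d θ) = evalSimplex X φ k hfree (bd c) θ := by
  have := hfin (k + 1)
  -- Defining `d` as the transpose of `bd` gives continuity at once; the face formula is read off at
  -- the identity of `G`.
  obtain ⟨d, hd⟩ := exists_toSimplicialCochain (X := X) (k := k + 1) hfree
    (evalSimplex X φ k hfree ∘ₗ bd) isAlt_evalSimplex.comp_bd (fun g l _ _ z y => by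
      rw [← lmap_gen, LinearMap.comp_apply, bd_lmap, evalSimplex_lmap]
      rfl)
  refine ⟨d, fun θ σ => ?_, hd⟩
  have h := congrArg (fun u : φ.Ell G => u 1) (hd _ σ.gen_list_mem θ)
  simp only [evalSimplex_list, one_smul] at h
  rw [h]
  let ev : φ.Ell G →ₗ[ℝ] ℝ :=
    { toFun := fun f => f 1, map_add' := fun _ _ => rfl, map_smul' := fun _ _ => rfl }
  change ev (evalSimplex X φ k hfree (bd (gen (List.ofFn σ.vertex))) θ) = _
  rw [bd_ofFn]
  simp only [map_sum, map_smul, sum_apply, smul_apply]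
  refine Finset.sum_congr rfl fun i _ => ?_
  rw [smul_eq_mul]
  congr 1
  exact (evalSimplex_list (σ.face i) θ 1).trans (by rw [one_smul])

/-- The maps `α`, `β`, `τ`, `σ` are the transposes of `a`, `b`, `t`, `s`. A cochain is determined by
its evaluations on chains, so each required identity is the evaluation of the corresponding chain
identity. -/
theorem homotopyEquivalent_groupCoboundary [TopologicalSpace G] [DiscreteTopology G]
    (hfree : ∀ (g : G) (v : V), g • v = v → g = 1)
    (hfin : ∀ k, Finite (MulAction.orbitRel.Quotient G (OrderedSimplex X k)))
    (hX : Acyclic (faceLists X)) (hne : ∃ s, s ∈ X.faces)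
    (d : ∀ k, SimplicialCochain X φ k →L[ℝ] SimplicialCochain X φ (k + 1))
    (hd : ∀ k, ∀ c ∈ chains (faceLists X) (k + 2), ∀ θ,
      evalSimplex X φ (k + 1) hfree c (d k θ) = evalSimplex X φ k hfree (bd c) θ) :
    HomotopyEquivalent (groupCoboundary φ G) d := by
  obtain ⟨a, b, s, t, ⟨haalt, hsalt, hs0, ht0⟩, hV, hG⟩ :=
    exists_equivariant_equivalence hfree hX hne
  have hVgen : ∀ {k : ℕ} {l : List V}, l ∈ faceLists X → l.length = k + 1 →
      gen l ∈ chains (faceLists X) (k + 1) := fun hl hn => gen_mem_chains hl hn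
  have hGgen : ∀ {k : ℕ} {l : List G}, l.length = k + 1 → gen l ∈ chains Set.univ (k + 1) :=
    fun hn => gen_mem_chains trivial hn
  have hα : ∀ k, ∃ α : InvariantCochain φ G k →L[ℝ] SimplicialCochain X φ k,
      ∀ c ∈ chains (faceLists X) (k + 1), ∀ ω,
        evalSimplex X φ k hfree c (α ω) = evalGroup φ G k (a c) ω := fun k =>
    exists_toSimplicialCochain hfree (evalGroup φ G k ∘ₗ a) (haalt.map_comp _)
      fun g l hl hn z y => by
        obtain ⟨h1, -, -, -, h2⟩ := hV _ _ (hVgen hl hn)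
        rw [← lmap_gen, LinearMap.comp_apply, (h2 g).1, evalGroup_lmap g h1]
        rfl
  have hσ : ∀ k, ∃ h : SimplicialCochain X φ (k + 1) →L[ℝ] SimplicialCochain X φ k,
      ∀ c ∈ chains (faceLists X) (k + 1), ∀ θ,
        evalSimplex X φ k hfree c (h θ) = evalSimplex X φ (k + 1) hfree (s c) θ := fun k =>
    exists_toSimplicialCochain hfree (evalSimplex X φ (k + 1) hfree ∘ₗ s) (hsalt.map_comp _)
      fun g l hl hn z y => by
        obtain ⟨-, -, -, -, h2⟩ := hV _ _ (hVgen hl hn)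
        rw [← lmap_gen, LinearMap.comp_apply, (h2 g).2, evalSimplex_lmap]
        rfl
  have hβ : ∀ k, ∃ β : SimplicialCochain X φ k →L[ℝ] InvariantCochain φ G k,
      ∀ c ∈ chains Set.univ (k + 1), ∀ θ,
        evalGroup φ G k c (β θ) = evalSimplex X φ k hfree (b c) θ := fun k =>
    exists_toInvariantCochain (evalSimplex X φ k hfree ∘ₗ b) fun g l hn z y => by
      obtain ⟨-, -, -, -, h2⟩ := hG _ _ (hGgen hn)
      rw [← lmap_gen, LinearMap.comp_apply, (h2 g).1, evalSimplex_lmap]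
      rfl
  have hτ : ∀ k, ∃ h : InvariantCochain φ G (k + 1) →L[ℝ] InvariantCochain φ G k,
      ∀ c ∈ chains Set.univ (k + 1), ∀ ω,
        evalGroup φ G k c (h ω) = evalGroup φ G (k + 1) (t c) ω := fun k =>
    exists_toInvariantCochain (evalGroup φ G (k + 1) ∘ₗ t) fun g l hn z y => by
      obtain ⟨-, h1, -, -, h2⟩ := hG _ _ (hGgen hn)
      rw [← lmap_gen, LinearMap.comp_apply, (h2 g).2, evalGroup_lmap g h1]
      rfl
  choose α hα using hα
  choose σ hσ using hσ
  choose β hβ using hβ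
  choose τ hτ using hτ
  have hbdV : ∀ {n : ℕ} {c : Ch V}, c ∈ chains (faceLists X) (n + 1) →
      bd c ∈ chains (faceLists X) n := fun hc => faceClosed_faceLists.bd_mem hc
  have hbdG : ∀ {n : ℕ} {c : Ch G}, c ∈ chains Set.univ (n + 1) →
      bd c ∈ chains Set.univ n :=
    fun hc => FaceClosed.bd_mem (B := Set.univ) (fun _ _ _ _ => trivial) hc
  refine ⟨α, β, τ, σ, fun k ω => SimplicialCochain.ext_evalSimplex hfree fun c hc => ?_,
    fun k θ => InvariantCochain.ext_evalGroup fun c hc => ?_,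
    fun ω => InvariantCochain.ext_evalGroup fun c hc => ?_,
    fun k ω => InvariantCochain.ext_evalGroup fun c hc => ?_,
    fun θ => SimplicialCochain.ext_evalSimplex hfree fun c hc => ?_,
    fun k θ => SimplicialCochain.ext_evalSimplex hfree fun c hc => ?_⟩
  · obtain ⟨h1, -, h3, -, -⟩ := hV _ _ hc
    rw [hα _ c hc, evalGroup_coboundary h1, h3, hd k c hc, hα k _ (hbdV hc)]
  · obtain ⟨h1, -, h3, -, -⟩ := hG _ _ hc
    rw [hβ _ c hc, hd k _ h1, h3, evalGroup_coboundary hc, hβ k _ (hbdG hc)]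
  · obtain ⟨h1, h2, -, h4, -⟩ := hG _ _ hc
    -- In degree zero `bd c` is a multiple of the empty list, where `t` vanishes, so the
    -- augmentation leaves no term.
    rw [map_eq_zero_of_mem_chains_zero ht0 (hbdG hc), add_zero] at h4
    rw [hτ 0 c hc, evalGroup_coboundary h2, h4, map_sub, map_sub, hβ 0 c hc, hα 0 _ h1]
    rfl
  · obtain ⟨h1, h2, -, h4, -⟩ := hG _ _ hc
    have e : evalGroup φ G (k + 1) (bd (t c) + t (bd c)) ω =
        evalGroup φ G (k + 1) (c - a (b c)) ω := by rw [h4]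
    rw [map_add, map_sub, add_apply, sub_apply] at e
    rw [map_sub, map_add, hβ _ c hc, hα _ _ h1, ← e, evalGroup_coboundary hc, hτ k _ (hbdG hc),
      hτ (k + 1) c hc, evalGroup_coboundary h2, add_comm]
  · obtain ⟨h1, h2, -, h4, -⟩ := hV _ _ hc
    rw [map_eq_zero_of_mem_chains_zero hs0 (hbdV hc), add_zero] at h4
    have e : evalSimplex X φ 0 hfree (bd (s c)) θ =
        evalSimplex X φ 0 hfree (alt c - b (a c)) θ := by rw [h4]
    -- The chain homotopy ends at `alt c`; evaluation on a simplicial cochain replaces it by `c`.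
    rw [map_sub, sub_apply, isAlt_evalSimplex.apply_alt] at e
    rw [map_sub, hα 0 c hc, hβ 0 _ h1, ← e, hσ 0 c hc, hd 0 _ h2]
  · obtain ⟨h1, h2, -, h4, -⟩ := hV _ _ hc
    have e : evalSimplex X φ (k + 1) hfree (bd (s c) + s (bd c)) θ =
        evalSimplex X φ (k + 1) hfree (alt c - b (a c)) θ := by rw [h4]
    rw [map_add, map_sub, add_apply, sub_apply,
      isAlt_evalSimplex.apply_alt] at e
    have e₁ := (hα (k + 1) c hc (β (k + 1) θ)).trans (hβ (k + 1) (a c) h1 θ)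
    have e₂ := (hd k c hc (σ k θ)).trans (hσ k (bd c) (hbdV hc) θ)
    have e₃ := (hσ (k + 1) c hc (d (k + 1) θ)).trans (hd (k + 1) (s c) h2 θ)
    rw [map_sub, map_add]
    exact (congrArg₂ (· - ·) rfl e₁).trans
      (e.symm.trans ((add_comm _ _).trans (congrArg₂ (· + ·) e₂.symm e₃.symm)))

end Main

end OrliczCohomology

theorem mainTheorem5 {G : Type*} [Group G] [TopologicalSpace G] [DiscreteTopology G]
    {V : Type*} (X : AbstractSimplicialComplex V) [MulAction G V] [SimplicialAction G X]
    (hfin : IsLocallyFinite X) (hcontr : ContractibleSpace (Realization X))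
    (hproper : ProperlyDiscontinuousSMul G (Realization X))
    (hcocompact : ∃ K : Set (Realization X), IsCompact K ∧ ∀ x, ∃ g : G, ∃ y ∈ K, g • y = x)
    (hfree : ∀ (g : G) (x : Realization X), g • x = x → g = 1)
    (φ : YoungFunction) :
    ∃ d : ∀ k, SimplicialCochain X φ k →L[ℝ] SimplicialCochain X φ (k + 1),
      (∀ (k : ℕ) (θ : SimplicialCochain X φ k) (σ : OrderedSimplex X (k + 1)),
        (d k θ).1 σ = ∑ i : Fin (k + 2), (-1 : ℝ) ^ (i : ℕ) * θ.1 (σ.face i)) ∧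
      HomotopyEquivalent (groupCoboundary φ G) d ∧
      (∀ k, Nonempty (Cohomology (groupCoboundary φ G) k ≃L[ℝ] Cohomology d k)) ∧
      (∀ k, Nonempty
        (ReducedCohomology (groupCoboundary φ G) k ≃L[ℝ] ReducedCohomology d k)) := by
  obtain ⟨W, hW⟩ := exists_finite_vertices hfin hcocompact
  have hfreeV := free_on_vertices hfree
  -- Contractibility enters here, with the dimension bound that cocompactness provides; the same `W`
  -- yields the finiteness of orbits below.
  have hX : Acyclic (faceLists X) := acyclic_faceLists hfin (card_le_of_vertices hW)
  have hne : ∃ s, s ∈ X.faces := by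
    obtain ⟨t⟩ : Nonempty (Realization X) := inferInstance
    obtain ⟨s, hs, -⟩ := exists_support t
    exact ⟨s, hs⟩
  choose d hd1 hd2 using exists_simplicialCoboundary (φ := φ) hfreeV (finite_orbits hW)
  have hequiv := homotopyEquivalent_groupCoboundary hfreeV (finite_orbits hW) hX hne d hd2
  exact ⟨d, hd1, hequiv, hequiv.nonempty_cohomology_equiv,
    hequiv.nonempty_reducedCohomology_equiv⟩
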